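/- **Setting.** Let $n,k\ge 1$, $d\ge 2$, let $u\in\mathbb R^d$ satisfy $\|u\|_2=1$ and have support $S=\{i:u_i\neq 0\}$ with $|S|\le k$, let $0<\theta\le 1$, and let $\mathbf X\in\mathbb R^{n\times d}$ have i.i.d. rows distributed as $\mathcal N(0,I_d+\theta uu^\top)$. Write $\mathbf X_i$ for the $i$-th column and $\mathbf X_{-i}\in\mathbb R^{n\times(d-1)}$ for $\mathbf X$ with that column deleted. **Black box.** For $\mathbb X\in\mathbb R^{n\times p}$ let $\gamma(\mathbb X)$ be the largest $\gamma\ge 0$ such that $\frac1n\|\mathbb X\beta\|_2^2\ge\gamma\|\beta\|_2^2$ for all $\beta\in\mathbb R^p$ for which some $A\subseteq[p]$ with $|A|=k$ satisfies $\|\beta_{A^c}\|_1\le 3\|\beta_A\|_1$. A solver for sparse linear regression is a measurable map $(y,\mathbb X,k)\mapsto \mathsf{SLR}(y,\mathbb X,k)\in\mathbb R^p$, for $y\in\mathbb R^n$, with $k$-sparse output. It satisfies the black-box condition with constants $c,c',c''>0$ if, for all $n\ge 1$, $p\ge 2$, $1\le k\le p$, all fixed $\mathbb X\in\mathbb R^{n\times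 p}$ with $\gamma(\mathbb X)>0$, all $k$-sparse $\beta^\ast\in\mathbb R^p$ and all $\sigma>0$, the output $\widehat\beta=\mathsf{SLR}(\mathbb X\beta^\ast+w,\mathbb X,k)$ with $w\sim\mathcal N(0,\sigma^2I_n)$ satisfies $$\frac1n\|\mathbb X\widehat\beta-\mathbb X\beta^\ast\|_2^2\le\frac{c}{\min(\gamma(\mathbb X),1)^2}\cdot\frac{\sigma^2k\log p}{n}\quad\text{with probability at least }1-c'\exp(-c''k\log p).$$ **Algorithm ($Q$-support recovery).** For $i=1,\dots,d$ put $\widehat\beta_i=\mathsf{SLR}(\mathbf X_i,\mathbf X_{-i},k)$ and $Q_i=\frac1n\|\mathbf X_i\|_2^2-\frac1n\|\mathbf X_i-\mathbf X_{-i}\widehat\beta_i\|_2^2$. Return $\widehat S=\{i: Q_i>\frac{13k\log(d/k)}{n}\}$. **Theorem (Support recovery).** For all $c,c',c''>0$ there are constants $c_1,c_2,c_3,c_4>0$, depending only on $c,c',c''$, such that the following holds for every solver that satisfies the black-box condition with constants $c,c',c''$ and for all $n,d,k,\theta,u$ as above. Let $0<c_{\min}<1$ and suppose that - $c_{\min}^2/k\le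 u_i^2\le 1-c_{\min}^2/k$ for at least one $i\in[d]$; - $|u_i|\ge c_{\min}/\sqrt k$ for every $i\in S$; - $d/k\ge e$, and $k\le d^{1-\varepsilon}$ for some $\varepsilon>0$; - $n>c_2k\log d$ and $\theta^2>\frac{c_1}{c_{\min}^2}\cdot\frac{k^2\log d}{n}$. Then $\widehat S=S$ with probability at least $1-c_3\exp(-c_4\,\varepsilon\,k\log d)$. Moreover, if each call of the solver on an $n\times p$ instance with sparsity $k$ takes time $T(p,n,k)$, then on every input with $n,d\ge 1$ the algorithm runs in time $O(d\,T(d-1,n,k)+d^2n)$ on a unit-cost real random access machine (arithmetic, logarithms, comparisons and memory accesses cost one unit), with an absolute implied constant. -/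

import Mathlib

open MeasureTheory ProbabilityTheory
open scoped NNReal Matrix

noncomputable section

/-! ### Vectors, sparsity, restricted eigenvalues -/

/-- Squared Euclidean norm of a real vector. -/
def sqNorm {m : ℕ} (v : Fin m → ℝ) : ℝ := ∑ t, v t ^ 2

/-- The support of a vector, as a finite set of coordinates. -/
def suppF {m : ℕ} (v : Fin m → ℝ) : Finset (Fin m) := Finset.univ.filter fun j => v j ≠ 0

/-- The `ℓ₀`-ball: vectors with at most `k` nonzero entries. -/
def IsSparse {m : ℕ} (k : ℕ) (v : Fin m → ℝ) : Prop := (suppF v).card ≤ k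

/-- The cone `{β : ‖β_{Sᶜ}‖₁ ≤ 3 ‖β_S‖₁}`. -/
def reCone {p : ℕ} (S : Finset (Fin p)) : Set (Fin p → ℝ) :=
  {β | ∑ j ∈ Sᶜ, |β j| ≤ 3 * ∑ j ∈ S, |β j|}

/-- The restricted eigenvalue constant of an `n × p` design at sparsity `k`: the largest `γ` with
`γ ‖β‖² ≤ ‖Xβ‖² / n` on the union of the cones of all `k`-subsets. The set always contains `0`
and, for `1 ≤ k ≤ p`, it is closed and bounded above; so the value is `0` exactly when no positive
constant is admissible. -/
def reConst {n p : ℕ} (X : Matrix (Fin n) (Fin p) ℝ) (k : ℕ) : ℝ :=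
  sSup {γ : ℝ | ∀ S : Finset (Fin p), S.card = k → ∀ β ∈ reCone S,
    γ * sqNorm β ≤ sqNorm (X *ᵥ β) / n}

/-! ### Solvers for sparse linear regression -/

/-- A black box for sparse linear regression: from the response `y ∈ ℝⁿ`, the `n × p` design `X`
and the sparsity `k` it returns an estimate in `ℝᵖ`. -/
abbrev SLRSolver : Type :=
  (n p : ℕ) → (Fin n → ℝ) → Matrix (Fin n) (Fin p) ℝ → ℕ → (Fin p → ℝ)

/-- For all sizes, the solver is jointly Borel measurable in the response and the (entries of the)
design. -/
def SLRSolver.IsMeasurable (slr : SLRSolver) : Prop :=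
  ∀ n p k : ℕ, Measurable fun yX : (Fin n → ℝ) × (Fin n → Fin p → ℝ) =>
    slr n p yX.1 (Matrix.of yX.2) k

/-- The law of a noise vector with i.i.d. `N(0, σ²)` entries. -/
def noiseLaw (n : ℕ) (σ : ℝ≥0) : Measure (Fin n → ℝ) :=
  Measure.pi fun _ => gaussianReal 0 (σ ^ 2)

/-- The black-box condition with constants `c, c', c''`: the output is always `k`-sparse and, for
every fixed design `X` whose restricted eigenvalue is positive, every `k`-sparse `β⋆` and every
noise level `σ`, for `y = Xβ⋆ + w` with `w ∼ N(0, σ² Iₙ)`, the prediction error is at most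
`c / γ(X)² · σ² k log p / n` with probability at least `1 - c' exp (-c'' k log p)`.
The restricted eigenvalue is capped at `1`: prediction error does not change when `X` is rescaled,
so without a normalization of `X` no solver could satisfy the uncapped bound. The cap only weakens
what is asked of the solver. -/
def SLRSolver.BlackBox (slr : SLRSolver) (c c' c'' : ℝ) : Prop :=
  (∀ (n p k : ℕ) (y : Fin n → ℝ) (X : Matrix (Fin n) (Fin p) ℝ), IsSparse k (slr n p y X k)) ∧
  ∀ n p k : ℕ, 1 ≤ n → 2 ≤ p → 1 ≤ k → k ≤ p →
    ∀ X : Matrix (Fin n) (Fin p) ℝ, 0 < reConst X k →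
    ∀ βs : Fin p → ℝ, IsSparse k βs → ∀ σ : ℝ≥0, 0 < σ →
      1 - c' * Real.exp (-c'' * k * Real.log p) ≤
        (noiseLaw n σ).real
          {w | sqNorm (X *ᵥ slr n p (X *ᵥ βs + w) X k - X *ᵥ βs) / n ≤
            c / (min (reConst X k) 1) ^ 2 * ((σ : ℝ) ^ 2 * k * Real.log p / n)}

/-! ### The single spiked covariance model -/

/-- The law of `n` i.i.d. samples from `N(0, I + θ u uᵀ)` in `ℝᵈ`. -/
def spikedLaw (n : ℕ) {d : ℕ} (θ : ℝ) (u : EuclideanSpace ℝ (Fin d)) :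
    Measure (Fin n → EuclideanSpace ℝ (Fin d)) :=
  Measure.pi fun _ => multivariateGaussian 0 (1 + θ • Matrix.vecMulVec u u)

/-- The data matrix whose rows are the samples. -/
def dataMatrix {n d : ℕ} (x : Fin n → EuclideanSpace ℝ (Fin d)) : Matrix (Fin n) (Fin d) ℝ :=
  Matrix.of fun t j => x t j

/-- At least one coordinate has enough mass without carrying almost all of it. -/
def SpikeSpread {d : ℕ} (k : ℕ) (cmin : ℝ) (u : Fin d → ℝ) : Prop :=
  ∃ i, cmin ^ 2 / k ≤ u i ^ 2 ∧ u i ^ 2 ≤ 1 - cmin ^ 2 / k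

/-- All coordinates on the support have size at least `cmin / √k`. -/
def SpikeMin {d : ℕ} (k : ℕ) (cmin : ℝ) (u : Fin d → ℝ) : Prop :=
  ∀ i, u i ≠ 0 → cmin / √(k : ℝ) ≤ |u i|

/-! ### The `Q`-support recovery algorithm -/

/-- The `n × (d-1)` matrix obtained by deleting column `i`, where `d = p + 1`. -/
def dropCol {n p : ℕ} (X : Matrix (Fin n) (Fin (p + 1)) ℝ) (i : Fin (p + 1)) :
    Matrix (Fin n) (Fin p) ℝ :=
  X.submatrix id i.succAbove

/-- The statistic `Q_i = ‖X_i‖² / n - ‖X_i - X_{-i} β̂_i‖² / n`, with `β̂_i = SLR(X_i, X_{-i}, k)`. -/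
def qStat (slr : SLRSolver) {n p : ℕ} (X : Matrix (Fin n) (Fin (p + 1)) ℝ) (k : ℕ)
    (i : Fin (p + 1)) : ℝ :=
  sqNorm (X.col i) / n -
    sqNorm (X.col i - dropCol X i *ᵥ slr n p (X.col i) (dropCol X i) k) / n

/-- The output `Ŝ = {i : Q_i > 13 k log (d / k) / n}` of `Q`-support recovery, `d = p + 1`. -/
def qSupport (slr : SLRSolver) {n p : ℕ} (X : Matrix (Fin n) (Fin (p + 1)) ℝ) (k : ℕ) :
    Finset (Fin (p + 1)) :=
  Finset.univ.filter fun i =>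
    13 * k * Real.log (((p + 1 : ℕ) : ℝ) / k) / n < qStat slr X k i

/-! ### A real random access machine with calls to the black box

Programs have natural-number registers (used for indices and loop counters) and
two-dimensional real arrays. Every arithmetic operation, memory access, comparison, assignment and
loop step costs one unit; a call of the black box on an `n × p` instance with sparsity `k` costs
`T p n k` units on top. -/

/-- Index expressions. -/
inductive IdxExp : Type
  | const (m : ℕ)
  | reg (r : ℕ)
  | add (e f : IdxExp)
  | sub (e f : IdxExp)

/-- Real expressions: `get a e f` reads the entry `(e, f)` of array `a`. -/
inductive RealExp : Type
  | ofIdx (e : IdxExp)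
  | get (a : ℕ) (e f : IdxExp)
  | add (x y : RealExp)
  | sub (x y : RealExp)
  | mul (x y : RealExp)
  | div (x y : RealExp)
  | log (x : RealExp)

/-- Programs. `loop r e c` runs `c` with register `r` set to `0, 1, …, e - 1` in turn (the bound is
evaluated once). `callSLR b y X n p k` calls the black box on the response stored in column `0` of
array `y` and the design stored in array `X`, and stores the answer in column `0` of array `b`. -/
inductive Prog : Type
  | skip
  | setIdx (r : ℕ) (e : IdxExp)
  | setReal (a : ℕ) (e f : IdxExp) (x : RealExp)
  | seq (c₁ c₂ : Prog)
  | ifIdxLt (e f : IdxExp) (c₁ c₂ : Prog)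
  | ifRealLt (x y : RealExp) (c₁ c₂ : Prog)
  | loop (r : ℕ) (e : IdxExp) (c : Prog)
  | callSLR (b y X : ℕ) (n p k : IdxExp)

/-- Machine states. -/
structure MState : Type where
  idx : ℕ → ℕ
  arr : ℕ → ℕ → ℕ → ℝ

/-- Write a register. -/
def MState.setIdx (s : MState) (r m : ℕ) : MState :=
  { s with idx := fun r' => if r' = r then m else s.idx r' }

/-- Write one array entry. -/
def MState.setReal (s : MState) (a i j : ℕ) (x : ℝ) : MState :=
  { s with arr := fun a' i' j' => if a' = a ∧ i' = i ∧ j' = j then x else s.arr a' i' j' }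

/-- Write a vector to column `0` of an array. -/
def MState.setVec (s : MState) (a : ℕ) {m : ℕ} (v : Fin m → ℝ) : MState :=
  { s with arr := fun a' i' j' =>
      if h : i' < m then (if a' = a ∧ j' = 0 then v ⟨i', h⟩ else s.arr a' i' j')
      else s.arr a' i' j' }

def IdxExp.eval (s : MState) : IdxExp → ℕ
  | const m => m
  | reg r => s.idx r
  | add e f => e.eval s + f.eval s
  | sub e f => e.eval s - f.eval s

def IdxExp.cost : IdxExp → ℕ
  | const _ => 1
  | reg _ => 1
  | add e f => e.cost + f.cost + 1
  | sub e f => e.cost + f.cost + 1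

def RealExp.eval (s : MState) : RealExp → ℝ
  | ofIdx e => (e.eval s : ℝ)
  | get a e f => s.arr a (e.eval s) (f.eval s)
  | add x y => x.eval s + y.eval s
  | sub x y => x.eval s - y.eval s
  | mul x y => x.eval s * y.eval s
  | div x y => x.eval s / y.eval s
  | log x => Real.log (x.eval s)

def RealExp.cost : RealExp → ℕ
  | ofIdx e => e.cost + 1
  | get _ e f => e.cost + f.cost + 1
  | add x y => x.cost + y.cost + 1
  | sub x y => x.cost + y.cost + 1
  | mul x y => x.cost + y.cost + 1
  | div x y => x.cost + y.cost + 1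
  | log x => x.cost + 1

/-- Run `body 0`, …, `body (m - 1)` in turn, adding up the costs, with one extra unit per round. -/
def iterCost (body : ℕ → MState → MState × ℕ) : ℕ → MState → MState × ℕ
  | 0, s => (s, 0)
  | m + 1, s =>
    ((body m (iterCost body m s).1).1,
      (iterCost body m s).2 + (body m (iterCost body m s).1).2 + 1)

open Classical in
/-- Final state and number of steps of a program, for the black box `slr` with running time `T`. -/
def Prog.run (slr : SLRSolver) (T : ℕ → ℕ → ℕ → ℕ) : Prog → MState → MState × ℕ
  | skip, s => (s, 1)
  | setIdx r e, s => (s.setIdx r (e.eval s), e.cost + 1)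
  | setReal a e f x, s =>
    (s.setReal a (e.eval s) (f.eval s) (x.eval s), e.cost + f.cost + x.cost + 1)
  | seq c₁ c₂, s =>
    ((c₂.run slr T (c₁.run slr T s).1).1,
      (c₁.run slr T s).2 + (c₂.run slr T (c₁.run slr T s).1).2)
  | ifIdxLt e f c₁ c₂, s =>
    if e.eval s < f.eval s
    then ((c₁.run slr T s).1, (c₁.run slr T s).2 + e.cost + f.cost + 1)
    else ((c₂.run slr T s).1, (c₂.run slr T s).2 + e.cost + f.cost + 1)
  | ifRealLt x y c₁ c₂, s =>
    if x.eval s < y.eval s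
    then ((c₁.run slr T s).1, (c₁.run slr T s).2 + x.cost + y.cost + 1)
    else ((c₂.run slr T s).1, (c₂.run slr T s).2 + x.cost + y.cost + 1)
  | loop r e c, s =>
    ((iterCost (fun i s' => c.run slr T (s'.setIdx r i)) (e.eval s) s).1,
      (iterCost (fun i s' => c.run slr T (s'.setIdx r i)) (e.eval s) s).2 + e.cost + 1)
  | callSLR b y X n p k, s =>
    (s.setVec b (slr (n.eval s) (p.eval s) (fun t => s.arr y t 0)
        (Matrix.of fun t j => s.arr X t j) (k.eval s)),
      T (p.eval s) (n.eval s) (k.eval s) + n.cost + p.cost + k.cost + 1)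

/-- The initial state: registers `0, 1, 2` hold `n, d, k`, array `0` holds the data matrix, and
everything else is `0`. -/
def initState {n d : ℕ} (X : Matrix (Fin n) (Fin d) ℝ) (k : ℕ) : MState where
  idx := fun r => if r = 0 then n else if r = 1 then d else if r = 2 then k else 0
  arr := fun a i j =>
    if h : a = 0 ∧ i < n ∧ j < d then X ⟨i, h.2.1⟩ ⟨j, h.2.2⟩ else 0

/-- In a final state, column `0` of array `1` holds the indicator vector of the set `S`. -/
def MState.Outputs (s : MState) {d : ℕ} (S : Finset (Fin d)) : Prop :=
  ∀ i : Fin d, s.arr 1 i 0 = if i ∈ S then 1 else 0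

end

/-! Given the other columns, a column of the data is a linear combination of them plus independent
Gaussian noise, so in each regression the solver faces a fixed design, which the black-box condition
covers. For a coordinate outside the support the column is pure noise, and a `k`-sparse fit can
gain at most the squared norm of a projection of the noise onto one of the `k`-dimensional column
spans; a chi-square tail and a union bound over the spans keep `Qᵢ` below the threshold. For a
coordinate in the support the prediction variance is at least `θ² cmin² / (4 k)`, and a solver with
small prediction error realises most of it. The restricted eigenvalue that this requires follows
from finitely many inequalities, one for each sum of `512 k + 1` signed unit vectors: by Maurey's
empirical method, an average of such sums over random signed coordinates represents an arbitrary
vector of the cone. A union bound over the coordinates concludes. -/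

/-! ### Squared norms of Gaussian vectors -/

lemma gaussianPDFReal_smul_exp_mul_sq (a x : ℝ) :
    gaussianPDFReal 0 1 x • Real.exp (a * x ^ 2) =
      (√(2 * Real.pi))⁻¹ * Real.exp (-(1 / 2 - a) * x ^ 2) := by
  simp only [gaussianPDFReal, NNReal.coe_one, mul_one, sub_zero, smul_eq_mul]
  rw [mul_assoc, ← Real.exp_add]
  congr 2
  ring

lemma integrable_exp_mul_sq_gaussianReal {a : ℝ} (ha : a < 1 / 2) :
    Integrable (fun x => Real.exp (a * x ^ 2)) (gaussianReal 0 1) := by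
  rw [gaussianReal_of_var_ne_zero 0 one_ne_zero,
    integrable_withDensity_iff_integrable_smul' (measurable_gaussianPDF 0 1)
      (Filter.Eventually.of_forall fun x => gaussianPDF_lt_top)]
  simp only [toReal_gaussianPDF, gaussianPDFReal_smul_exp_mul_sq]
  exact (integrable_exp_neg_mul_sq (by linarith)).const_mul _

lemma integral_exp_mul_sq_gaussianReal {a : ℝ} (ha : a < 1 / 2) :
    ∫ x, Real.exp (a * x ^ 2) ∂gaussianReal 0 1 = (√(1 - 2 * a))⁻¹ := by
  rw [integral_gaussianReal_eq_integral_smul one_ne_zero]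
  simp only [gaussianPDFReal_smul_exp_mul_sq]
  rw [integral_const_mul, integral_gaussian, ← Real.sqrt_inv, ← Real.sqrt_inv,
    ← Real.sqrt_mul (by positivity)]
  congr 1
  field_simp [show 1 - 2 * a ≠ 0 by linarith, show 1 / 2 - a ≠ 0 by linarith]

section StdGaussian

variable {E : Type*} [NormedAddCommGroup E] [InnerProductSpace ℝ E] [FiniteDimensional ℝ E]

lemma norm_sq_sum_smul_stdOrthonormalBasis (x : Fin (Module.finrank ℝ E) → ℝ) :
    ‖∑ i, x i • stdOrthonormalBasis ℝ E i‖ ^ 2 = ∑ i, x i ^ 2 := by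
  rw [← real_inner_self_eq_norm_sq, (stdOrthonormalBasis ℝ E).orthonormal.inner_sum]
  simp [pow_two]

variable [MeasurableSpace E] [BorelSpace E]

lemma integrable_exp_mul_norm_sq_stdGaussian {a : ℝ} (ha : a < 1 / 2) :
    Integrable (fun x => Real.exp (a * ‖x‖ ^ 2)) (stdGaussian E) := by
  rw [stdGaussian, integrable_map_measure (by fun_prop) (Measurable.aemeasurable (by fun_prop))]
  simp only [Function.comp_def, norm_sq_sum_smul_stdOrthonormalBasis, Finset.mul_sum, Real.exp_sum]
  exact Integrable.fintype_prod fun _ => integrable_exp_mul_sq_gaussianReal ha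

lemma mgf_norm_sq_stdGaussian {a : ℝ} (ha : a < 1 / 2) :
    mgf (fun x => ‖x‖ ^ 2) (stdGaussian E) a = (√(1 - 2 * a))⁻¹ ^ Module.finrank ℝ E := by
  rw [mgf, stdGaussian, integral_map (Measurable.aemeasurable (by fun_prop)) (by fun_prop)]
  simp only [norm_sq_sum_smul_stdOrthonormalBasis, Finset.mul_sum, Real.exp_sum]
  rw [integral_fintype_prod_eq_pow (fun x : ℝ => Real.exp (a * x ^ 2)),
    integral_exp_mul_sq_gaussianReal ha, Fintype.card_fin]

lemma stdGaussian_norm_sq_ge_le (t : ℝ) :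
    (stdGaussian E).real {x | t ≤ ‖x‖ ^ 2} ≤
      2 ^ Module.finrank ℝ E * Real.exp (-(3 / 8) * t) := by
  have h_sqrt : (√(1 - 2 * (3 / 8) : ℝ))⁻¹ = 2 := by
    rw [show (1 - 2 * (3 / 8) : ℝ) = (1 / 2) ^ 2 by norm_num, Real.sqrt_sq (by norm_num)]
    norm_num
  have h_chernoff := measure_ge_le_exp_mul_mgf (μ := stdGaussian E) (X := fun x => ‖x‖ ^ 2) t
    (by norm_num : (0 : ℝ) ≤ 3 / 8) (integrable_exp_mul_norm_sq_stdGaussian (by norm_num))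
  rwa [mgf_norm_sq_stdGaussian (by norm_num), h_sqrt, mul_comm] at h_chernoff

lemma stdGaussian_four_mul_finrank_le_norm_sq_le :
    (stdGaussian E).real {x | 4 * Module.finrank ℝ E ≤ ‖x‖ ^ 2} ≤
      Real.exp (-(Module.finrank ℝ E / 12)) := by
  have h_two : (2 : ℝ) ≤ Real.exp 1 := by linarith [Real.exp_one_gt_d9]
  calc _ ≤ 2 ^ Module.finrank ℝ E * Real.exp (-(3 / 8) * (4 * Module.finrank ℝ E)) :=
        stdGaussian_norm_sq_ge_le _
    _ ≤ Real.exp 1 ^ Module.finrank ℝ E * Real.exp (-(3 / 8) * (4 * Module.finrank ℝ E)) := by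
        gcongr
    _ = Real.exp (-(Module.finrank ℝ E / 2)) := by
        rw [← Real.exp_nat_mul, ← Real.exp_add]
        ring_nf
    _ ≤ _ := by
        gcongr
        norm_num

lemma inv_sqrt_two_le_exp : (√2)⁻¹ ≤ Real.exp (-(1 / 3)) := by
  rw [Real.exp_neg]
  gcongr
  apply Real.le_sqrt_of_sq_le
  rw [← Real.exp_nat_mul, ← Real.le_log_iff_exp_le two_pos]
  norm_num
  linarith [Real.log_two_gt_d9]

lemma stdGaussian_norm_sq_le_half_finrank_le :
    (stdGaussian E).real {x | ‖x‖ ^ 2 ≤ Module.finrank ℝ E / 2} ≤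
      Real.exp (-(Module.finrank ℝ E / 12)) := by
  have h_chernoff := measure_le_le_exp_mul_mgf (μ := stdGaussian E) (X := fun x => ‖x‖ ^ 2)
    (Module.finrank ℝ E / 2 : ℝ) (by norm_num : -(1 / 2 : ℝ) ≤ 0)
    (integrable_exp_mul_norm_sq_stdGaussian (by norm_num))
  rw [mgf_norm_sq_stdGaussian (by norm_num), show (1 : ℝ) - 2 * -(1 / 2) = 2 by norm_num]
    at h_chernoff
  calc _ ≤ _ := h_chernoff
    _ ≤ Real.exp (- -(1 / 2) * (Module.finrank ℝ E / 2)) *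
        Real.exp (-(1 / 3)) ^ Module.finrank ℝ E := by
        gcongr
        exact inv_sqrt_two_le_exp
    _ = _ := by
        rw [← Real.exp_nat_mul, ← Real.exp_add]
        ring_nf

lemma stdGaussian_map_orthogonalProjectionOnto (V : Submodule ℝ E) :
    (stdGaussian E).map V.orthogonalProjectionOnto = stdGaussian V := by
  apply Measure.ext_of_charFun
  ext v
  have h_charFun := charFun_stdGaussian (v : E)
  rw [charFun_apply] at h_charFun
  rw [charFun_stdGaussian, charFun_apply, integral_map (by fun_prop) (by fun_prop)]
  simp only [Submodule.inner_orthogonalProjectionOnto_eq_of_mem_right, h_charFun,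
    Submodule.coe_norm]

lemma stdGaussian_norm_sq_orthogonalProjectionOnto_ge_le (V : Submodule ℝ E) (t : ℝ) :
    (stdGaussian E).real {x | t ≤ ‖V.orthogonalProjectionOnto x‖ ^ 2} ≤
      2 ^ Module.finrank ℝ V * Real.exp (-(3 / 8) * t) := by
  have h_tail := stdGaussian_norm_sq_ge_le (E := V) t
  rwa [← stdGaussian_map_orthogonalProjectionOnto V, map_measureReal_apply (by fun_prop)
    (measurableSet_le (by fun_prop) (by fun_prop))] at h_tail

end StdGaussian

lemma sqNorm_eq_norm_sq {m : ℕ} (v : Fin m → ℝ) : sqNorm v = ‖WithLp.toLp 2 v‖ ^ 2 := by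
  simp [sqNorm, EuclideanSpace.real_norm_sq_eq]

lemma sqNorm_nonneg {m : ℕ} (v : Fin m → ℝ) : 0 ≤ sqNorm v :=
  Finset.sum_nonneg fun _ _ => sq_nonneg _

lemma sqNorm_smul {m : ℕ} (a : ℝ) (v : Fin m → ℝ) : sqNorm (a • v) = a ^ 2 * sqNorm v := by
  simp [sqNorm, Finset.mul_sum, mul_pow]

@[fun_prop]
lemma measurable_sqNorm {m : ℕ} : Measurable (sqNorm (m := m)) := by
  unfold sqNorm
  fun_prop

instance isProbabilityMeasure_noiseLaw (n : ℕ) (σ : ℝ≥0) :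
    IsProbabilityMeasure (noiseLaw n σ) := by
  unfold noiseLaw
  infer_instance

lemma noiseLaw_eq_map_stdGaussian (n : ℕ) (σ : ℝ≥0) :
    noiseLaw n σ =
      (stdGaussian (EuclideanSpace ℝ (Fin n))).map fun x => (σ : ℝ) • WithLp.ofLp x := by
  have h_coord : gaussianReal 0 (σ ^ 2) = (gaussianReal 0 1).map ((σ : ℝ) * ·) := by
    rw [gaussianReal_map_const_mul]
    congr 1
    · simp
    · ext
      simp
  rw [← map_pi_eq_stdGaussian, Measure.map_map (by fun_prop) (by fun_prop), noiseLaw, h_coord,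
    ← Measure.pi_map_pi fun _ => by fun_prop]
  rfl

lemma noiseLaw_real_le_stdGaussian {n : ℕ} (σ : ℝ≥0) {s : Set (Fin n → ℝ)}
    {s' : Set (EuclideanSpace ℝ (Fin n))} (hs : MeasurableSet s)
    (hss' : ∀ x : EuclideanSpace ℝ (Fin n), (σ : ℝ) • WithLp.ofLp x ∈ s → x ∈ s') :
    (noiseLaw n σ).real s ≤ (stdGaussian (EuclideanSpace ℝ (Fin n))).real s' := by
  rw [noiseLaw_eq_map_stdGaussian, map_measureReal_apply (by fun_prop) hs]
  exact measureReal_mono hss'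

lemma noiseLaw_sqNorm_gt_le (n : ℕ) (σ : ℝ≥0) :
    (noiseLaw n σ).real {w | 4 * n * (σ : ℝ) ^ 2 < sqNorm w} ≤ Real.exp (-(n / 12)) := by
  refine (noiseLaw_real_le_stdGaussian σ (measurableSet_lt (by fun_prop) (by fun_prop))
    fun x hx => ?_).trans ((stdGaussian_four_mul_finrank_le_norm_sq_le
      (E := EuclideanSpace ℝ (Fin n))).trans_eq (by simp))
  rw [Set.mem_ofPred_eq, sqNorm_smul, sqNorm_eq_norm_sq, mul_comm] at hx
  rw [Set.mem_ofPred_eq, finrank_euclideanSpace_fin]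
  exact (lt_of_mul_lt_mul_left hx (by positivity)).le

lemma noiseLaw_sqNorm_lt_le (n : ℕ) (σ : ℝ≥0) :
    (noiseLaw n σ).real {w | sqNorm w < n / 2 * (σ : ℝ) ^ 2} ≤ Real.exp (-(n / 12)) := by
  refine (noiseLaw_real_le_stdGaussian σ (measurableSet_lt (by fun_prop) (by fun_prop))
    fun x hx => ?_).trans ((stdGaussian_norm_sq_le_half_finrank_le
      (E := EuclideanSpace ℝ (Fin n))).trans_eq (by simp))
  rw [Set.mem_ofPred_eq, sqNorm_smul, sqNorm_eq_norm_sq, mul_comm (n / 2 : ℝ)] at hx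
  rw [Set.mem_ofPred_eq, finrank_euclideanSpace_fin]
  exact (lt_of_mul_lt_mul_left hx (by positivity)).le

lemma noiseLaw_norm_sq_orthogonalProjectionOnto_gt_le {n : ℕ} (σ : ℝ≥0)
    (V : Submodule ℝ (EuclideanSpace ℝ (Fin n))) (t : ℝ) :
    (noiseLaw n σ).real
        {w | (σ : ℝ) ^ 2 * t < ‖V.orthogonalProjectionOnto (WithLp.toLp 2 w)‖ ^ 2} ≤
      2 ^ Module.finrank ℝ V * Real.exp (-(3 / 8) * t) := by
  refine (noiseLaw_real_le_stdGaussian σ (measurableSet_lt (by fun_prop) (by fun_prop))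
    fun x hx => ?_).trans (stdGaussian_norm_sq_orthogonalProjectionOnto_ge_le V t)
  rw [Set.mem_ofPred_eq, WithLp.toLp_smul, map_smul, norm_smul, mul_pow, Real.norm_eq_abs,
    sq_abs] at hx
  exact (lt_of_mul_lt_mul_left hx (by positivity)).le

/-! ### Gain in fit for a fixed design -/

/-- The decrease `‖y‖² / n - ‖y - Xβ̂‖² / n` of the mean squared residual achieved by the solver:
`Q_i` is the gain in fit for the response `X_i` and the design `X_{-i}`. -/
noncomputable def fitGain (slr : SLRSolver) {n p : ℕ} (X : Matrix (Fin n) (Fin p) ℝ) (k : ℕ)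
    (y : Fin n → ℝ) : ℝ :=
  sqNorm y / n - sqNorm (y - X *ᵥ slr n p y X k) / n

/-- The span of the columns of `X` with index in `A`, as a subspace of Euclidean space. -/
noncomputable def colSpan {n p : ℕ} (X : Matrix (Fin n) (Fin p) ℝ) (A : Finset (Fin p)) :
    Submodule ℝ (EuclideanSpace ℝ (Fin n)) :=
  Submodule.span ℝ (A.image fun j => WithLp.toLp 2 (X.col j) : Finset _)

lemma mem_suppF {m : ℕ} {v : Fin m → ℝ} {j : Fin m} : j ∈ suppF v ↔ v j ≠ 0 := by
  simp [suppF]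

section InnerProductSpace

variable {E : Type*} [NormedAddCommGroup E] [InnerProductSpace ℝ E] (V : Submodule ℝ E)
  [V.HasOrthogonalProjection]

lemma abs_inner_le_norm_orthogonalProjectionOnto_mul_norm (w : E) {v : E} (hv : v ∈ V) :
    |inner ℝ w v| ≤ ‖V.orthogonalProjectionOnto w‖ * ‖v‖ := by
  rw [← Submodule.inner_orthogonalProjectionOnto_eq_of_mem_right ⟨v, hv⟩ w]
  exact abs_real_inner_le_norm _ _

lemma two_mul_inner_sub_norm_sq_le (w : E) {v : E} (hv : v ∈ V) :
    2 * inner ℝ w v - ‖v‖ ^ 2 ≤ ‖V.orthogonalProjectionOnto w‖ ^ 2 := by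
  have h_inner := abs_inner_le_norm_orthogonalProjectionOnto_mul_norm V w hv
  linarith [le_abs_self (inner ℝ w v), two_mul_le_add_sq ‖V.orthogonalProjectionOnto w‖ ‖v‖]

lemma thirteen_mul_lt_norm_sq_sub_norm_sq {s w v : E} {κ c : ℝ} (hκ : 0 < κ) (hv : v ∈ V)
    (hw : ‖V.orthogonalProjectionOnto w‖ ^ 2 ≤ 32 * κ) (hvs : ‖v - s‖ ^ 2 ≤ 32 * c * κ)
    (hs : (220 + 128 * c) * κ ≤ ‖s‖ ^ 2) :
    13 * κ < ‖s + w‖ ^ 2 - ‖s + w - v‖ ^ 2 := by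
  set r := ‖V.orthogonalProjectionOnto w‖
  have h_gain : ‖s + w‖ ^ 2 - ‖s + w - v‖ ^ 2 = ‖s‖ ^ 2 + 2 * inner ℝ w v - ‖v - s‖ ^ 2 := by
    rw [norm_sub_sq_real, norm_sub_sq_real, inner_add_left, real_inner_comm v s]
    ring
  have h_inner : -(r * (‖s‖ + ‖v - s‖)) ≤ inner ℝ w v := by
    have h_norm : ‖v‖ ≤ ‖s‖ + ‖v - s‖ := by simpa using norm_add_le s (v - s)
    have h_abs := abs_inner_le_norm_orthogonalProjectionOnto_mul_norm V w hv
    have h_mono := mul_le_mul_of_nonneg_left h_norm (norm_nonneg (V.orthogonalProjectionOnto w))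
    linarith [neg_abs_le (inner ℝ w v)]
  have h_signal : 2 * (r * ‖s‖) ≤ ‖s‖ ^ 2 / 2 + 2 * r ^ 2 := by
    linarith [sq_nonneg (‖s‖ - 2 * r)]
  have h_error : 2 * (r * ‖v - s‖) ≤ r ^ 2 + ‖v - s‖ ^ 2 := by
    linarith [sq_nonneg (r - ‖v - s‖)]
  rw [h_gain]
  linarith

end InnerProductSpace

section FixedDesign

variable {n p k : ℕ}

lemma finrank_colSpan_le (X : Matrix (Fin n) (Fin p) ℝ) (A : Finset (Fin p)) :
    Module.finrank ℝ (colSpan X A) ≤ A.card :=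
  (finrank_span_finset_le_card _).trans Finset.card_image_le

lemma mulVec_mem_colSpan (X : Matrix (Fin n) (Fin p) ℝ) {A : Finset (Fin p)} {b : Fin p → ℝ}
    (hb : suppF b ⊆ A) : WithLp.toLp 2 (X *ᵥ b) ∈ colSpan X A := by
  have h_sum : WithLp.toLp 2 (X *ᵥ b) = ∑ j ∈ A, b j • WithLp.toLp 2 (X.col j) := by
    rw [Finset.sum_subset (Finset.subset_univ A)]
    · ext t
      simp [Matrix.mulVec, dotProduct, Matrix.col, mul_comm]
    · intro j _ hj
      have h_zero : b j = 0 := by_contra fun h => hj (hb (mem_suppF.2 h))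
      simp [h_zero]
  rw [h_sum]
  refine Submodule.sum_mem _ fun j hj => Submodule.smul_mem _ _ (Submodule.subset_span ?_)
  simpa using ⟨j, hj, rfl⟩

lemma IsSparse.exists_card_eq_superset {b : Fin p → ℝ} (hb : IsSparse k b) (hk : k ≤ p) :
    ∃ A : Finset (Fin p), A.card = k ∧ suppF b ⊆ A := by
  obtain ⟨A, h_sub, h_card⟩ := Finset.exists_superset_card_eq hb (by simpa using hk)
  exact ⟨A, h_card, h_sub⟩

lemma choose_le_exp_of_div_le_exp {L : ℝ} (hk : 1 ≤ k) (hL : 1 ≤ L)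
    (hp : (p : ℝ) / k ≤ Real.exp L) : (p.choose k : ℝ) ≤ Real.exp (2 * k * L) := by
  have hk0 : (0 : ℝ) < k := by exact_mod_cast hk
  calc (p.choose k : ℝ) ≤ (p : ℝ) ^ k / k.factorial := Nat.choose_le_pow_div k p
    _ = ((p : ℝ) / k) ^ k * ((k : ℝ) ^ k / k.factorial) := by
        rw [div_pow]
        field_simp
    _ ≤ Real.exp L ^ k * Real.exp k := by
        gcongr
        exact Real.pow_div_factorial_le_exp _ hk0.le k
    _ = Real.exp (k * L + k * 1) := by rw [← Real.exp_nat_mul, ← Real.exp_add, mul_one]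
    _ ≤ _ := by
        gcongr
        nlinarith

lemma two_pow_le_exp_mul {L : ℝ} (k : ℕ) (hL : 1 ≤ L) : (2 : ℝ) ^ k ≤ Real.exp (k * L) := by
  have h_two : (2 : ℝ) ≤ Real.exp L := by linarith [Real.add_one_le_exp L]
  rw [Real.exp_nat_mul]
  gcongr

lemma noiseLaw_exists_norm_sq_projection_colSpan_gt_le (σ : ℝ≥0)
    (X : Matrix (Fin n) (Fin p) ℝ) (k : ℕ) (t : ℝ) :
    (noiseLaw n σ).real {w | ∃ A : Finset (Fin p), A.card = k ∧
        (σ : ℝ) ^ 2 * t < ‖(colSpan X A).orthogonalProjectionOnto (WithLp.toLp 2 w)‖ ^ 2} ≤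
      p.choose k * (2 ^ k * Real.exp (-(3 / 8) * t)) := by
  set large : Finset (Fin p) → Set (Fin n → ℝ) := fun A =>
    {w | (σ : ℝ) ^ 2 * t < ‖(colSpan X A).orthogonalProjectionOnto (WithLp.toLp 2 w)‖ ^ 2}
  have h_tail : ∀ A ∈ Finset.powersetCard k (Finset.univ : Finset (Fin p)),
      (noiseLaw n σ).real (large A) ≤ 2 ^ k * Real.exp (-(3 / 8) * t) := by
    intro A hA
    refine (noiseLaw_norm_sq_orthogonalProjectionOnto_gt_le σ _ t).trans ?_
    gcongr
    · norm_num
    · exact (finrank_colSpan_le X A).trans (Finset.mem_powersetCard_univ.1 hA).le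
  calc _ = (noiseLaw n σ).real
        (⋃ A ∈ Finset.powersetCard k (Finset.univ : Finset (Fin p)), large A) := by
        congr 1
        ext w
        simp [large]
    _ ≤ _ := measureReal_biUnion_finset_le _ _
    _ ≤ _ := Finset.sum_le_card_nsmul _ _ _ h_tail
    _ = _ := by simp

lemma noiseLaw_fitGain_gt_le {slr : SLRSolver}
    (hslr : ∀ (n p k : ℕ) (y : Fin n → ℝ) (X : Matrix (Fin n) (Fin p) ℝ),
      IsSparse k (slr n p y X k))
    (hn : 1 ≤ n) (hk : 1 ≤ k) (hkp : k ≤ p) {L : ℝ} (hL : 1 ≤ L)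
    (hp : (p : ℝ) / k ≤ Real.exp L) (X : Matrix (Fin n) (Fin p) ℝ) :
    (noiseLaw n 1).real {w | 13 * k * L / n < fitGain slr X k w} ≤
      Real.exp (-(3 / 2 * k * L)) := by
  have hn0 : (0 : ℝ) < n := by exact_mod_cast hn
  have h_sub : {w | 13 * k * L / n < fitGain slr X k w} ⊆
      {w | ∃ A : Finset (Fin p), A.card = k ∧ ((1 : ℝ≥0) : ℝ) ^ 2 * (13 * k * L) <
        ‖(colSpan X A).orthogonalProjectionOnto (WithLp.toLp 2 w)‖ ^ 2} := by
    intro w hw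
    obtain ⟨A, h_card, h_supp⟩ := (hslr n p k w X).exists_card_eq_superset hkp
    rw [Set.mem_ofPred_eq, fitGain, ← sub_div, div_lt_div_iff_of_pos_right hn0,
      sqNorm_eq_norm_sq, sqNorm_eq_norm_sq, WithLp.toLp_sub, norm_sub_sq_real] at hw
    have h_proj := two_mul_inner_sub_norm_sq_le (colSpan X A) (WithLp.toLp 2 w)
      (mulVec_mem_colSpan X h_supp)
    refine ⟨A, h_card, ?_⟩
    rw [NNReal.coe_one, one_pow, one_mul]
    linarith
  calc _ ≤ _ := measureReal_mono h_sub
    _ ≤ _ := noiseLaw_exists_norm_sq_projection_colSpan_gt_le 1 X k _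
    _ ≤ Real.exp (2 * k * L) * (Real.exp (k * L) * Real.exp (-(3 / 8) * (13 * k * L))) := by
        gcongr
        · exact choose_le_exp_of_div_le_exp hk hL hp
        · exact two_pow_le_exp_mul k hL
    _ = Real.exp (-(15 / 8 * (k * L))) := by
        rw [← Real.exp_add, ← Real.exp_add]
        ring_nf
    _ ≤ _ := Real.exp_le_exp.2 (by
        linarith [mul_nonneg (Nat.cast_nonneg (α := ℝ) k) (zero_le_one.trans hL)])

lemma measurable_mulVec {α : Type*} [MeasurableSpace α] {Z : α → Matrix (Fin n) (Fin p) ℝ}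
    {b : α → Fin p → ℝ} (hZ : ∀ t j, Measurable fun a => Z a t j) (hb : Measurable b) :
    Measurable fun a => Z a *ᵥ b a := by
  refine measurable_pi_lambda _ fun t => ?_
  simp only [Matrix.mulVec, dotProduct]
  fun_prop

lemma SLRSolver.IsMeasurable.measurable_apply {slr : SLRSolver} (hslr : slr.IsMeasurable)
    {α : Type*} [MeasurableSpace α] {y : α → Fin n → ℝ} {Z : α → Matrix (Fin n) (Fin p) ℝ}
    (hy : Measurable y) (hZ : ∀ t j, Measurable fun a => Z a t j) :
    Measurable fun a => slr n p (y a) (Z a) k :=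
  (hslr n p k).comp (f := fun a => (y a, fun t j => Z a t j)) (by fun_prop)

lemma SLRSolver.BlackBox.noiseLaw_sqNorm_error_gt_le {slr : SLRSolver} {c c' c'' : ℝ}
    (hslr : slr.BlackBox c c' c'') (hmeas : slr.IsMeasurable) (hc : 0 < c) (hn : 1 ≤ n)
    (hp : 2 ≤ p) (hk : 1 ≤ k) (hkp : k ≤ p) {ℓ : ℝ} (hpℓ : Real.log p ≤ ℓ)
    {X : Matrix (Fin n) (Fin p) ℝ} (hX : 1 / 4 ≤ reConst X k) {βs : Fin p → ℝ}
    (hβ : IsSparse k βs) {σ : ℝ≥0} (hσ : 0 < σ) (hσ2 : (σ : ℝ) ^ 2 ≤ 2) :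
    (noiseLaw n σ).real
        {w | 32 * c * (k * ℓ) < sqNorm (X *ᵥ slr n p (X *ᵥ βs + w) X k - X *ᵥ βs)} ≤
      c' * Real.exp (-c'' * k * Real.log p) := by
  have hn0 : (0 : ℝ) < n := by exact_mod_cast hn
  have hp1 : (1 : ℝ) ≤ p := by exact_mod_cast one_le_two.trans hp
  have h_sq : (1 / 4 : ℝ) ^ 2 ≤ min (reConst X k) 1 ^ 2 := by
    gcongr
    exact le_min hX (by norm_num)
  have h_const : c / min (reConst X k) 1 ^ 2 ≤ 16 * c := by
    rw [div_le_iff₀ (by positivity)]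
    nlinarith
  set good : Set (Fin n → ℝ) := {w | sqNorm (X *ᵥ slr n p (X *ᵥ βs + w) X k - X *ᵥ βs) / n ≤
    c / min (reConst X k) 1 ^ 2 * ((σ : ℝ) ^ 2 * k * Real.log p / n)}
  have h_good : MeasurableSet good := by
    have h_slr : Measurable fun w : Fin n → ℝ => slr n p (X *ᵥ βs + w) X k :=
      hmeas.measurable_apply (by fun_prop) (by fun_prop)
    have h_mulVec := measurable_mulVec (Z := fun _ => X) (fun _ _ => measurable_const) h_slr
    exact measurableSet_le ((measurable_sqNorm.comp (h_mulVec.sub_const _)).div_const _)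
      measurable_const
  have h_sub : {w | 32 * c * (k * ℓ) < sqNorm (X *ᵥ slr n p (X *ᵥ βs + w) X k - X *ᵥ βs)} ⊆
      goodᶜ := by
    intro w hw h_mem
    have h_bound : c / min (reConst X k) 1 ^ 2 * ((σ : ℝ) ^ 2 * k * Real.log p / n) ≤
        16 * c * (2 * k * ℓ / n) := by
      have := Real.log_nonneg hp1
      gcongr
    have h_error := (div_le_iff₀ hn0).1 (h_mem.trans h_bound)
    rw [mul_assoc, div_mul_cancel₀ _ hn0.ne'] at h_error
    rw [Set.mem_ofPred_eq] at hw
    linarith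
  refine (measureReal_mono h_sub).trans ?_
  rw [probReal_compl_eq_one_sub h_good]
  linarith [hslr.2 n p k hn hp hk hkp X (by linarith) βs hβ σ hσ]

lemma fitGain_gt_of_norm_sq_projection_le {slr : SLRSolver} (hn : 1 ≤ n) {κ c : ℝ} (hκ : 0 < κ)
    {X : Matrix (Fin n) (Fin p) ℝ} {βs : Fin p → ℝ} {w : Fin n → ℝ}
    (hsig : (220 + 128 * c) * κ ≤ sqNorm (X *ᵥ βs))
    (herr : sqNorm (X *ᵥ slr n p (X *ᵥ βs + w) X k - X *ᵥ βs) ≤ 32 * c * κ)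
    {A : Finset (Fin p)} (hA : suppF (slr n p (X *ᵥ βs + w) X k) ⊆ A)
    (hw : ‖(colSpan X A).orthogonalProjectionOnto (WithLp.toLp 2 w)‖ ^ 2 ≤ 32 * κ) :
    13 * κ / n < fitGain slr X k (X *ᵥ βs + w) := by
  have hn0 : (0 : ℝ) < n := by exact_mod_cast hn
  rw [sqNorm_eq_norm_sq] at hsig
  rw [sqNorm_eq_norm_sq, WithLp.toLp_sub] at herr
  rw [fitGain, ← sub_div, div_lt_div_iff_of_pos_right hn0, sqNorm_eq_norm_sq, sqNorm_eq_norm_sq,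
    WithLp.toLp_sub, WithLp.toLp_add]
  exact thirteen_mul_lt_norm_sq_sub_norm_sq (colSpan X A) hκ (mulVec_mem_colSpan X hA) hw herr hsig

lemma noiseLaw_fitGain_le_le {slr : SLRSolver} {c c' c'' : ℝ} (hslr : slr.BlackBox c c' c'')
    (hmeas : slr.IsMeasurable) (hc : 0 < c) (hn : 1 ≤ n) (hp : 2 ≤ p) (hk : 1 ≤ k) (hkp : k ≤ p)
    {ℓ : ℝ} (hℓ : 1 ≤ ℓ) (hpℓ : Real.log p ≤ ℓ) {X : Matrix (Fin n) (Fin p) ℝ}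
    (hX : 1 / 4 ≤ reConst X k) {βs : Fin p → ℝ} (hβ : IsSparse k βs)
    (hsig : (220 + 128 * c) * (k * ℓ) ≤ sqNorm (X *ᵥ βs)) {σ : ℝ≥0} (hσ : 0 < σ)
    (hσ2 : (σ : ℝ) ^ 2 ≤ 2) :
    (noiseLaw n σ).real {w | fitGain slr X k (X *ᵥ βs + w) ≤ 13 * (k * ℓ) / n} ≤
      c' * Real.exp (-c'' * k * Real.log p) + Real.exp (-(4 * k * ℓ)) := by
  have hk1 : (1 : ℝ) ≤ k := by exact_mod_cast hk
  set error : Set (Fin n → ℝ) :=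
    {w | 32 * c * (k * ℓ) < sqNorm (X *ᵥ slr n p (X *ᵥ βs + w) X k - X *ᵥ βs)}
  set large : Set (Fin n → ℝ) := {w | ∃ A : Finset (Fin p), A.card = k ∧ (σ : ℝ) ^ 2 *
    (16 * (k * ℓ)) < ‖(colSpan X A).orthogonalProjectionOnto (WithLp.toLp 2 w)‖ ^ 2}
  have h_sub : {w | fitGain slr X k (X *ᵥ βs + w) ≤ 13 * (k * ℓ) / n} ⊆ error ∪ large := by
    intro w hw
    by_contra h_not
    rw [Set.mem_union, not_or] at h_not
    obtain ⟨A, h_card, h_supp⟩ := (hslr.1 n p k (X *ᵥ βs + w) X).exists_card_eq_superset hkp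
    have h_proj : ‖(colSpan X A).orthogonalProjectionOnto (WithLp.toLp 2 w)‖ ^ 2 ≤
        (σ : ℝ) ^ 2 * (16 * (k * ℓ)) := not_lt.1 fun h => h_not.2 ⟨A, h_card, h⟩
    refine (fitGain_gt_of_norm_sq_projection_le hn (by positivity) hsig (not_lt.1 h_not.1)
      h_supp (h_proj.trans ?_)).not_ge hw
    nlinarith [mul_pos (zero_lt_one.trans_le hk1) (zero_lt_one.trans_le hℓ)]
  have h_large : (noiseLaw n σ).real large ≤ Real.exp (-(4 * k * ℓ)) := by
    have h_choose : (p.choose k : ℝ) ≤ Real.exp (k * ℓ) := by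
      rw [Real.exp_nat_mul]
      have hp_exp := (Real.log_le_iff_le_exp (by positivity)).1 hpℓ
      calc (p.choose k : ℝ) ≤ (p : ℝ) ^ k := by exact_mod_cast Nat.choose_le_pow p k
        _ ≤ _ := by gcongr
    calc _ ≤ _ := noiseLaw_exists_norm_sq_projection_colSpan_gt_le σ X k _
      _ ≤ Real.exp (k * ℓ) * (Real.exp (k * ℓ) * Real.exp (-(3 / 8) * (16 * (k * ℓ)))) := by
          gcongr
          exact two_pow_le_exp_mul k hℓ
      _ = _ := by
          rw [← Real.exp_add, ← Real.exp_add]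
          ring_nf
  calc _ ≤ _ := measureReal_mono h_sub
    _ ≤ _ := measureReal_union_le _ _
    _ ≤ _ := add_le_add
        (hslr.noiseLaw_sqNorm_error_gt_le hmeas hc hn hp hk hkp hpℓ hX hβ hσ hσ2) h_large

end FixedDesign

/-! ### Restricted eigenvalues from finitely many inequalities -/

/-- Averaging the hypothesis over independent random indices `J l`, each equal to `j` with
probability proportional to `w j` (Maurey's empirical method), gives the conclusion; the weights
are not normalized. -/
lemma bilinForm_average_nonneg {M ι : Type*} [AddCommGroup M] [Module ℝ M] [Fintype ι]
    {B : LinearMap.BilinForm ℝ M} (hB : B.IsSymm) (a : ι → M) {w : ι → ℝ} (hw : ∀ j, 0 ≤ w j)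
    (N : ℕ) (v : M) (h : ∀ J : Fin N → ι, 0 ≤ B (v + ∑ l, a (J l)) (v + ∑ l, a (J l))) :
    0 ≤ (∑ j, w j) ^ 2 * B v v + 2 * N * (∑ j, w j) * B v (∑ j, w j • a j) +
      N * (N - 1) * B (∑ j, w j • a j) (∑ j, w j • a j) +
      N * (∑ j, w j) * ∑ j, w j * B (a j) (a j) := by
  rcases (Finset.sum_nonneg fun j (_ : j ∈ Finset.univ) => hw j).eq_or_lt with h_zero | h_pos
  · have h_w : ∀ j, w j = 0 := by
      simpa using (Finset.sum_eq_zero_iff_of_nonneg fun j _ => hw j).1 h_zero.symm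
    simp [h_w]
  set W := ∑ j, w j with hW
  set b := ∑ j, w j • a j with hb
  set q := ∑ j, w j * B (a j) (a j) with hq
  induction N generalizing v with
  | zero => simpa using mul_nonneg (sq_nonneg W) (h Fin.elim0)
  | succ N ih =>
    have h_cons : ∀ j, 0 ≤ W ^ 2 * B (v + a j) (v + a j) + 2 * N * W * B (v + a j) b +
        N * (N - 1) * B b b + N * W * q := fun j => ih _ fun J => by
      simpa [Fin.sum_univ_succ, add_assoc] using h (Fin.cons j J)
    have h_sum := Finset.sum_nonneg fun j (_ : j ∈ Finset.univ) => mul_nonneg (hw j) (h_cons j)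
    have h_right : ∀ x, ∑ j, w j * B x (a j) = B x b := fun x => by simp [hb, map_sum]
    have h_left : ∑ j, w j * B (a j) b = B b b := by
      simp only [← h_right b, hB.eq]
    have h_expand : ∀ j, w j * (W ^ 2 * B (v + a j) (v + a j) + 2 * N * W * B (v + a j) b +
        N * (N - 1) * B b b + N * W * q) =
        w j * (W ^ 2 * B v v + 2 * N * W * B v b + N * (N - 1) * B b b + N * W * q) +
        2 * W ^ 2 * (w j * B v (a j)) + W ^ 2 * (w j * B (a j) (a j)) +
        2 * N * W * (w j * B (a j) b) := by
      intro j
      simp only [map_add, LinearMap.add_apply]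
      rw [← hB.eq v (a j)]
      ring
    simp only [h_expand, Finset.sum_add_distrib, ← Finset.mul_sum, ← Finset.sum_mul, h_left,
      h_right, ← hq, ← hW] at h_sum
    refine nonneg_of_mul_nonneg_right (h_sum.trans_eq ?_) h_pos
    push_cast
    ring

section RestrictedEigenvalue

variable {n p k N : ℕ}

/-- The signed unit vectors `± e_j`, the sign being `+` for `true`. -/
def signedUnit (x : Fin p × Bool) : Fin p → ℝ :=
  (if x.2 then (1 : ℝ) else -1) • Pi.single x.1 1

/-- The finite net on which the design is tested: sums of `N` signed unit vectors. -/
def signedSum (J : Fin N → Fin p × Bool) : Fin p → ℝ := ∑ l, signedUnit (J l)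

/-- The bilinear form `⟨Xu, Xv⟩ / n - ⟨u, v⟩ / 2`. -/
noncomputable def excessForm (X : Matrix (Fin n) (Fin p) ℝ) : LinearMap.BilinForm ℝ (Fin p → ℝ) :=
  LinearMap.mk₂ ℝ (fun u v => (X *ᵥ u) ⬝ᵥ (X *ᵥ v) / n - u ⬝ᵥ v / 2)
    (fun u v w => by simp [Matrix.mulVec_add, add_dotProduct]; ring)
    (fun c u v => by simp [Matrix.mulVec_smul]; ring)
    (fun u v w => by simp [Matrix.mulVec_add, dotProduct_add]; ring)
    (fun c u v => by simp [Matrix.mulVec_smul]; ring)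

lemma excessForm_self (X : Matrix (Fin n) (Fin p) ℝ) (v : Fin p → ℝ) :
    excessForm X v v = sqNorm (X *ᵥ v) / n - sqNorm v / 2 := by
  simp [excessForm, sqNorm, dotProduct, pow_two]

lemma isSymm_excessForm (X : Matrix (Fin n) (Fin p) ℝ) : (excessForm X).IsSymm :=
  ⟨fun x y => by simp [excessForm, dotProduct_comm]⟩

lemma excessForm_signedUnit_le {X : Matrix (Fin n) (Fin p) ℝ} {B : ℝ}
    (hcol : ∀ j, sqNorm (X.col j) / n ≤ B) (x : Fin p × Bool) :
    excessForm X (signedUnit x) (signedUnit x) ≤ B := by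
  have h_col : sqNorm (X *ᵥ signedUnit x) = sqNorm (X.col x.1) := by
    rw [signedUnit, Matrix.mulVec_smul, sqNorm_smul, Matrix.mulVec_single_one]
    split_ifs <;> simp
  rw [excessForm_self, h_col]
  linarith [hcol x.1, sqNorm_nonneg (signedUnit x)]

lemma exists_nonneg_sum_smul_signedUnit (β : Fin p → ℝ) :
    ∃ w : Fin p × Bool → ℝ, (∀ x, 0 ≤ w x) ∧ ∑ x, w x = ∑ j, |β j| ∧
      ∑ x, w x • signedUnit x = β := by
  refine ⟨fun x => if x.2 then (β x.1)⁺ else (β x.1)⁻, fun x => ?_, ?_, ?_⟩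
  · dsimp only
    split_ifs
    exacts [posPart_nonneg _, negPart_nonneg _]
  · simp [Fintype.sum_prod_type, posPart_add_negPart]
  · have h_coord : ∀ j, (β j)⁺ • Pi.single j (1 : ℝ) + -((β j)⁻ • Pi.single j (1 : ℝ)) =
        (Pi.single j (β j) : Fin p → ℝ) := fun j => by
      rw [← sub_eq_add_neg, ← sub_smul, posPart_sub_negPart, ← Pi.single_smul,
        smul_eq_mul, mul_one]
    simp [Fintype.sum_prod_type, signedUnit, h_coord, Finset.univ_sum_single]

lemma excessForm_self_nonneg_of_signedSum {X : Matrix (Fin n) (Fin p) ℝ} {B : ℝ} (hN : 1 ≤ N)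
    (hnet : ∀ J : Fin N → Fin p × Bool,
      sqNorm (signedSum J) / 2 ≤ sqNorm (X *ᵥ signedSum J) / n)
    (hcol : ∀ j, sqNorm (X.col j) / n ≤ B) (β : Fin p → ℝ) :
    0 ≤ (N - 1) * excessForm X β β + B * (∑ j, |β j|) ^ 2 := by
  obtain ⟨w, hw, h_sum, h_smul⟩ := exists_nonneg_sum_smul_signedUnit β
  have h_avg := bilinForm_average_nonneg (isSymm_excessForm X) signedUnit hw N 0 fun J => by
    have h_net := hnet J
    rw [signedSum] at h_net
    rw [zero_add, excessForm_self]
    linarith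
  have h_self : ∑ x, w x * excessForm X (signedUnit x) (signedUnit x) ≤
      (∑ j, |β j|) * B := by
    rw [← h_sum, Finset.sum_mul]
    exact Finset.sum_le_sum fun x _ =>
      mul_le_mul_of_nonneg_left (excessForm_signedUnit_le hcol x) (hw x)
  simp only [h_sum, h_smul, map_zero, LinearMap.zero_apply, mul_zero, zero_add] at h_avg
  have hN0 : (0 : ℝ) < N := by exact_mod_cast hN
  have h_ℓ1 : 0 ≤ ∑ j, |β j| := Finset.sum_nonneg fun _ _ => abs_nonneg _
  refine nonneg_of_mul_nonneg_right (h_avg.trans ?_) hN0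
  linarith [mul_le_mul_of_nonneg_left h_self (mul_nonneg hN0.le h_ℓ1)]

lemma sum_abs_sq_le_of_mem_reCone {A : Finset (Fin p)} {β : Fin p → ℝ} (hβ : β ∈ reCone A) :
    (∑ j, |β j|) ^ 2 ≤ 16 * A.card * sqNorm β := by
  have h_cone : ∑ j, |β j| ≤ 4 * ∑ j ∈ A, |β j| := by
    rw [reCone, Set.mem_ofPred_eq] at hβ
    linarith [Finset.sum_add_sum_compl A fun j => |β j|]
  have h_sub : ∑ j ∈ A, |β j| ^ 2 ≤ sqNorm β := by
    simp only [sq_abs, sqNorm]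
    exact Finset.sum_le_sum_of_subset_of_nonneg (Finset.subset_univ _) fun _ _ _ => sq_nonneg _
  calc (∑ j, |β j|) ^ 2 ≤ (4 * ∑ j ∈ A, |β j|) ^ 2 := by gcongr
    _ = 16 * (∑ j ∈ A, |β j|) ^ 2 := by ring
    _ ≤ 16 * (A.card * ∑ j ∈ A, |β j| ^ 2) := by
        gcongr
        exact sq_sum_le_card_mul_sum_sq
    _ ≤ 16 * (A.card * sqNorm β) := by gcongr
    _ = _ := by ring

lemma single_mem_reCone {A : Finset (Fin p)} {j : Fin p} (hj : j ∈ A) (a : ℝ) :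
    Pi.single j a ∈ reCone A := by
  have h_compl : ∑ i ∈ Aᶜ, |(Pi.single j a : Fin p → ℝ) i| = 0 :=
    Finset.sum_eq_zero fun i hi => by
      have h_ne : i ≠ j := fun h => Finset.mem_compl.1 hi (h ▸ hj)
      simp [h_ne]
  rw [reCone, Set.mem_ofPred_eq, h_compl]
  exact mul_nonneg (by norm_num) (Finset.sum_nonneg fun _ _ => abs_nonneg _)

lemma le_reConst (X : Matrix (Fin n) (Fin p) ℝ) (hk : 1 ≤ k) (hkp : k ≤ p) {γ : ℝ}
    (h : ∀ A : Finset (Fin p), A.card = k → ∀ β ∈ reCone A,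
      γ * sqNorm β ≤ sqNorm (X *ᵥ β) / n) : γ ≤ reConst X k := by
  obtain ⟨A, -, hA⟩ := Finset.exists_subset_card_eq
    (show k ≤ (Finset.univ : Finset (Fin p)).card by simpa using hkp)
  obtain ⟨j, hj⟩ : A.Nonempty := Finset.card_pos.1 (by omega)
  have h_unit : sqNorm (Pi.single j 1 : Fin p → ℝ) = 1 := by simp [sqNorm, Pi.single_apply]
  refine le_csSup ⟨sqNorm (X *ᵥ Pi.single j 1) / n, fun γ' hγ' => ?_⟩ h
  simpa [h_unit] using hγ' A hA _ (single_mem_reCone hj 1)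

/- On the cone `‖β‖₁² ≤ 16 k ‖β‖²`, so with `N = 512 k + 1` the error `8 ‖β‖₁² / (N - 1)` of the
empirical method is at most `‖β‖² / 4`. -/
lemma quarter_le_reConst {X : Matrix (Fin n) (Fin p) ℝ} (hk : 1 ≤ k) (hkp : k ≤ p)
    (hnet : ∀ J : Fin (512 * k + 1) → Fin p × Bool,
      sqNorm (signedSum J) / 2 ≤ sqNorm (X *ᵥ signedSum J) / n)
    (hcol : ∀ j, sqNorm (X.col j) / n ≤ 8) : 1 / 4 ≤ reConst X k := by
  refine le_reConst X hk hkp fun A hA β hβ => ?_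
  have h_form := excessForm_self_nonneg_of_signedSum (by omega) hnet hcol β
  have h_cone := sum_abs_sq_le_of_mem_reCone hβ
  rw [hA] at h_cone
  push_cast at h_form
  have h_mul : 0 ≤ 512 * (k : ℝ) * (excessForm X β β + sqNorm β / 4) := by linarith
  have h_nonneg := nonneg_of_mul_nonneg_right h_mul
    (mul_pos (by norm_num) (Nat.cast_pos.2 hk))
  rw [excessForm_self] at h_nonneg
  linarith

end RestrictedEigenvalue

/-! ### The spiked covariance model -/

section Row

variable {d : ℕ} {θ : ℝ} {u : EuclideanSpace ℝ (Fin d)}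

/-- The law `N(0, I + θ u uᵀ)` of one sample of the spiked model. -/
noncomputable def spikedRow (θ : ℝ) (u : EuclideanSpace ℝ (Fin d)) :
    Measure (EuclideanSpace ℝ (Fin d)) :=
  multivariateGaussian 0 (1 + θ • Matrix.vecMulVec u u)

/-- The variance `aᵀ(I + θ u uᵀ)a` of the linear functional `⟨a, x⟩` of a sample `x`. -/
def spikedVar (θ : ℝ) (u : EuclideanSpace ℝ (Fin d)) (a : Fin d → ℝ) : ℝ :=
  a ⬝ᵥ a + θ * (a ⬝ᵥ u) ^ 2

instance isGaussian_spikedRow : IsGaussian (spikedRow θ u) := by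
  unfold spikedRow
  infer_instance

instance isProbabilityMeasure_spikedLaw (n : ℕ) : IsProbabilityMeasure (spikedLaw n θ u) := by
  unfold spikedLaw
  infer_instance

lemma spikedLaw_eq_pi_spikedRow (n : ℕ) (θ : ℝ) (u : EuclideanSpace ℝ (Fin d)) :
    spikedLaw n θ u = Measure.pi fun _ => spikedRow θ u := rfl

lemma spikedVar_nonneg (hθ : 0 ≤ θ) (a : Fin d → ℝ) : 0 ≤ spikedVar θ u a :=
  add_nonneg (Finset.sum_nonneg fun _ _ => mul_self_nonneg _) (mul_nonneg hθ (sq_nonneg _))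

lemma posSemidef_one_add_smul_vecMulVec (hθ : 0 ≤ θ) (v : Fin d → ℝ) :
    (1 + θ • Matrix.vecMulVec v v).PosSemidef :=
  Matrix.PosSemidef.one.add (.smul (by simpa using Matrix.posSemidef_vecMulVec_self_star v) hθ)

lemma dotProduct_eq_innerSL (a : Fin d → ℝ) :
    (fun x : EuclideanSpace ℝ (Fin d) => x ⬝ᵥ a) = innerSL ℝ (WithLp.toLp 2 a) := by
  ext x
  simp [EuclideanSpace.inner_eq_star_dotProduct]

lemma covariance_dotProduct_spikedRow (hθ : 0 ≤ θ) (a b : Fin d → ℝ) :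
    cov[fun x : EuclideanSpace ℝ (Fin d) => x ⬝ᵥ a, fun x => x ⬝ᵥ b; spikedRow θ u] =
      a ⬝ᵥ b + θ * ((a ⬝ᵥ u) * (b ⬝ᵥ u)) := by
  rw [dotProduct_eq_innerSL, dotProduct_eq_innerSL]
  refine (covarianceBilin_apply_eq_cov IsGaussian.memLp_two_id _ _).symm.trans ?_
  rw [spikedRow, covarianceBilin_multivariateGaussian (posSemidef_one_add_smul_vecMulVec hθ _)]
  simp only [Matrix.add_mulVec, Matrix.one_mulVec, dotProduct_add, Matrix.smul_mulVec,
    dotProduct_smul, Matrix.vecMulVec_mulVec, smul_eq_mul, op_smul_eq_smul]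
  rw [dotProduct_comm (u : Fin d → ℝ) b, mul_comm (b ⬝ᵥ _)]

lemma map_dotProduct_spikedRow (hθ : 0 ≤ θ) (a : Fin d → ℝ) {σ : ℝ≥0}
    (hσ : (σ : ℝ) ^ 2 = spikedVar θ u a) :
    (spikedRow θ u).map (fun x : EuclideanSpace ℝ (Fin d) => x ⬝ᵥ a) = gaussianReal 0 (σ ^ 2) := by
  have h_var : Var[fun x : EuclideanSpace ℝ (Fin d) => x ⬝ᵥ a; spikedRow θ u] = σ ^ 2 := by
    rw [← covariance_self (by fun_prop), covariance_dotProduct_spikedRow hθ, hσ, spikedVar,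
      pow_two (a ⬝ᵥ _)]
  rw [dotProduct_eq_innerSL] at h_var ⊢
  rw [IsGaussian.map_eq_gaussianReal, h_var, ContinuousLinearMap.integral_comp_id_comm
    IsGaussian.integrable_id, spikedRow, integral_id_multivariateGaussian, map_zero,
    ← NNReal.coe_pow, Real.toNNReal_coe]

lemma map_dataMatrix_mulVec_spikedLaw (n : ℕ) (hθ : 0 ≤ θ) (a : Fin d → ℝ) {σ : ℝ≥0}
    (hσ : (σ : ℝ) ^ 2 = spikedVar θ u a) :
    (spikedLaw n θ u).map (fun x => dataMatrix x *ᵥ a) = noiseLaw n σ := by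
  rw [noiseLaw, ← map_dotProduct_spikedRow hθ a hσ]
  exact Measure.pi_map_pi (f := fun _ (x : EuclideanSpace ℝ (Fin d)) => x ⬝ᵥ a)
    fun _ => by fun_prop

lemma exists_sq_eq_spikedVar (hθ : 0 ≤ θ) (a : Fin d → ℝ) :
    ∃ σ : ℝ≥0, (σ : ℝ) ^ 2 = spikedVar θ u a :=
  ⟨NNReal.sqrt (spikedVar θ u a).toNNReal, by
    rw [← NNReal.coe_pow, NNReal.sq_sqrt, Real.coe_toNNReal _ (spikedVar_nonneg hθ a)]⟩

lemma measurable_dataMatrix_mulVec (n : ℕ) (a : Fin d → ℝ) :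
    Measurable fun x : Fin n → EuclideanSpace ℝ (Fin d) => dataMatrix x *ᵥ a :=
  measurable_mulVec (fun t j => by simp only [dataMatrix, Matrix.of_apply]; fun_prop)
    measurable_const

lemma spikedLaw_sqNorm_mulVec_lt_le (n : ℕ) (hθ : 0 ≤ θ) (a : Fin d → ℝ) :
    (spikedLaw n θ u).real {x | sqNorm (dataMatrix x *ᵥ a) < n / 2 * spikedVar θ u a} ≤
      Real.exp (-(n / 12)) := by
  obtain ⟨σ, hσ⟩ := exists_sq_eq_spikedVar (u := u) hθ a
  have h_tail := noiseLaw_sqNorm_lt_le n σ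
  rwa [← map_dataMatrix_mulVec_spikedLaw n hθ a hσ, hσ, map_measureReal_apply
    (measurable_dataMatrix_mulVec n a) (measurableSet_lt measurable_sqNorm measurable_const)]
    at h_tail

lemma spikedLaw_sqNorm_mulVec_gt_le (n : ℕ) (hθ : 0 ≤ θ) (a : Fin d → ℝ) :
    (spikedLaw n θ u).real {x | 4 * n * spikedVar θ u a < sqNorm (dataMatrix x *ᵥ a)} ≤
      Real.exp (-(n / 12)) := by
  obtain ⟨σ, hσ⟩ := exists_sq_eq_spikedVar (u := u) hθ a
  have h_tail := noiseLaw_sqNorm_gt_le n σ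
  rwa [← map_dataMatrix_mulVec_spikedLaw n hθ a hσ, hσ, map_measureReal_apply
    (measurable_dataMatrix_mulVec n a) (measurableSet_lt measurable_const measurable_sqNorm)]
    at h_tail

end Row

/-! ### Regressing one coordinate on the others -/

section Product

variable {E F : Type*} [MeasurableSpace E] [MeasurableSpace F]

lemma pi_map_prodMk_of_indepFun {Ω : Type*} [MeasurableSpace Ω] {μ : Measure Ω}
    [IsProbabilityMeasure μ] {X : Ω → E} {Y : Ω → F} (hX : Measurable X) (hY : Measurable Y)
    (hXY : IndepFun X Y μ) (n : ℕ) :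
    (Measure.pi fun _ : Fin n => μ).map (fun x => (fun t => X (x t), fun t => Y (x t))) =
      (Measure.pi fun _ => μ.map X).prod (Measure.pi fun _ => μ.map Y) := by
  have := Measure.isProbabilityMeasure_map (μ := μ) hX.aemeasurable
  have := Measure.isProbabilityMeasure_map (μ := μ) hY.aemeasurable
  have := Measure.isProbabilityMeasure_map (μ := μ) (hX.prodMk hY).aemeasurable
  have h_row := (indepFun_iff_map_prod_eq_prod_map_map hX.aemeasurable hY.aemeasurable).1 hXY
  have h_pi : (Measure.pi fun _ : Fin n => μ).map (fun x t => (X (x t), Y (x t))) =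
      Measure.pi fun _ => μ.map fun ω => (X ω, Y ω) :=
    Measure.pi_map_pi (f := fun _ ω => (X ω, Y ω)) fun _ => (hX.prodMk hY).aemeasurable
  rw [← (measurePreserving_arrowProdEquivProdArrow E F (Fin n) (fun _ => μ.map X)
    (fun _ => μ.map Y)).map_eq, ← h_row, ← h_pi,
    Measure.map_map (MeasurableEquiv.measurable _) (by fun_prop)]
  rfl

lemma prod_measureReal_le_of_forall_mem {ν : Measure E} {ρ : Measure F}
    [IsProbabilityMeasure ν] [IsProbabilityMeasure ρ] {bad : Set (E × F)}
    (hbad : MeasurableSet bad) {good : Set E} (hgood : MeasurableSet good) {δ : ℝ} (hδ : 0 ≤ δ)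
    (h : ∀ z ∈ good, ρ.real (Prod.mk z ⁻¹' bad) ≤ δ) :
    (ν.prod ρ).real bad ≤ ν.real goodᶜ + δ := by
  have h_fiber : ∀ z, ρ (Prod.mk z ⁻¹' bad) ≤ goodᶜ.indicator 1 z + ENNReal.ofReal δ := fun z => by
    by_cases hz : z ∈ good
    · rw [← ofReal_measureReal]
      exact (ENNReal.ofReal_le_ofReal (h z hz)).trans le_add_self
    · rw [Set.indicator_of_mem hz]
      exact prob_le_one.trans le_self_add
  refine ENNReal.toReal_le_of_le_ofReal (add_nonneg measureReal_nonneg hδ) ?_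
  calc (ν.prod ρ) bad = ∫⁻ z, ρ (Prod.mk z ⁻¹' bad) ∂ν := Measure.prod_apply hbad
    _ ≤ ∫⁻ z, goodᶜ.indicator 1 z + ENNReal.ofReal δ ∂ν := lintegral_mono h_fiber
    _ = ν goodᶜ + ENNReal.ofReal δ := by
        rw [lintegral_add_right _ measurable_const, lintegral_indicator_one hgood.compl,
          lintegral_const, measure_univ, mul_one]
    _ = ENNReal.ofReal (ν.real goodᶜ + δ) := by
        rw [ENNReal.ofReal_add measureReal_nonneg hδ, ofReal_measureReal]

end Product

section Regression

variable {p : ℕ}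

/-- The coefficients of the regression of coordinate `i` on the other coordinates. -/
noncomputable def regCoef (θ : ℝ) (u : Fin (p + 1) → ℝ) (i : Fin (p + 1)) : Fin p → ℝ :=
  fun j => θ * u i / (1 + θ * (1 - u i ^ 2)) * u (i.succAbove j)

/-- The residual variance of the regression of coordinate `i` on the other coordinates. -/
noncomputable def regVar (θ : ℝ) (u : Fin (p + 1) → ℝ) (i : Fin (p + 1)) : ℝ :=
  1 + θ * u i ^ 2 / (1 + θ * (1 - u i ^ 2))

/-- The coordinates of a sample other than `i`: one row of the design with which coordinate `i` is
regressed. -/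
def otherCoords (i : Fin (p + 1)) (x : EuclideanSpace ℝ (Fin (p + 1))) : Fin p → ℝ :=
  fun j => x (i.succAbove j)

/-- The residual of the regression of coordinate `i` on the other coordinates. -/
noncomputable def regResidual (θ : ℝ) (u : Fin (p + 1) → ℝ) (i : Fin (p + 1))
    (x : EuclideanSpace ℝ (Fin (p + 1))) : ℝ :=
  x i - otherCoords i x ⬝ᵥ regCoef θ u i

lemma dotProduct_insertNth (i : Fin (p + 1)) (x : Fin (p + 1) → ℝ) (a : ℝ) (v : Fin p → ℝ) :
    x ⬝ᵥ (i.insertNth a v : Fin (p + 1) → ℝ) = x i * a + (fun j => x (i.succAbove j)) ⬝ᵥ v := by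
  simp [dotProduct, Fin.sum_univ_succAbove _ i]

lemma regResidual_eq_dotProduct (θ : ℝ) (u : Fin (p + 1) → ℝ) (i : Fin (p + 1)) :
    regResidual θ u i =
      fun x : EuclideanSpace ℝ (Fin (p + 1)) =>
        x ⬝ᵥ (i.insertNth 1 (-regCoef θ u i) : Fin (p + 1) → ℝ) := by
  ext x
  rw [dotProduct_insertNth, mul_one, dotProduct_neg, ← sub_eq_add_neg]
  rfl

lemma otherCoords_eq_dotProduct (i : Fin (p + 1)) (j : Fin p) :
    (fun x => otherCoords i x j) =
      fun x : EuclideanSpace ℝ (Fin (p + 1)) =>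
        x ⬝ᵥ (Pi.single (i.succAbove j) 1 : Fin (p + 1) → ℝ) := by
  ext x
  simp [otherCoords]

@[fun_prop]
lemma measurable_otherCoords (i : Fin (p + 1)) : Measurable (otherCoords i) := by
  unfold otherCoords
  fun_prop

@[fun_prop]
lemma measurable_regResidual (θ : ℝ) (u : Fin (p + 1) → ℝ) (i : Fin (p + 1)) :
    Measurable (regResidual θ u i) := by
  rw [regResidual_eq_dotProduct]
  fun_prop

variable {θ : ℝ} {u : EuclideanSpace ℝ (Fin (p + 1))}

lemma sum_sq_succAbove (hu : ‖u‖ = 1) (i : Fin (p + 1)) :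
    ∑ j, u (i.succAbove j) ^ 2 = 1 - u i ^ 2 := by
  have h_norm := EuclideanSpace.real_norm_sq_eq u
  rw [hu, Fin.sum_univ_succAbove _ i] at h_norm
  linarith

lemma sq_apply_le_one (hu : ‖u‖ = 1) (i : Fin (p + 1)) : u i ^ 2 ≤ 1 :=
  sub_nonneg.1 (sum_sq_succAbove hu i ▸ Finset.sum_nonneg fun _ _ => sq_nonneg _)

lemma regDenom_pos (hθ : 0 ≤ θ) (hu : ‖u‖ = 1) (i : Fin (p + 1)) :
    0 < 1 + θ * (1 - u i ^ 2) := by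
  linarith [mul_nonneg hθ (sub_nonneg.2 (sq_apply_le_one hu i))]

lemma regCoef_dotProduct_self (hu : ‖u‖ = 1) (i : Fin (p + 1)) :
    regCoef θ u i ⬝ᵥ regCoef θ u i =
      (θ * u i / (1 + θ * (1 - u i ^ 2))) ^ 2 * (1 - u i ^ 2) := by
  simp only [dotProduct, ← pow_two, regCoef, mul_pow, ← Finset.mul_sum, sum_sq_succAbove hu]

lemma regCoef_dotProduct_succAbove (hu : ‖u‖ = 1) (i : Fin (p + 1)) :
    (regCoef θ u i ⬝ᵥ fun j => u (i.succAbove j)) =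
      θ * u i / (1 + θ * (1 - u i ^ 2)) * (1 - u i ^ 2) := by
  simp only [dotProduct, regCoef, mul_assoc, ← pow_two, ← Finset.mul_sum, sum_sq_succAbove hu]

lemma spikedVar_insertNth_neg_regCoef (hθ : 0 ≤ θ) (hu : ‖u‖ = 1) (i : Fin (p + 1)) :
    spikedVar θ u (i.insertNth 1 (-regCoef θ u i)) = regVar θ u i := by
  rw [spikedVar, dotProduct_insertNth, dotProduct_comm _ (u : Fin (p + 1) → ℝ),
    dotProduct_insertNth]
  simp only [Fin.insertNth_apply_same, Fin.insertNth_apply_succAbove, Pi.neg_apply,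
    dotProduct_neg]
  rw [dotProduct_comm _ (regCoef θ u i), dotProduct_comm _ (regCoef θ u i),
    regCoef_dotProduct_succAbove hu, ← Pi.neg_def, dotProduct_neg, regCoef_dotProduct_self hu,
    regVar]
  have h_denom := (regDenom_pos hθ hu i).ne'
  field_simp
  ring

lemma covariance_otherCoords_regResidual (hθ : 0 ≤ θ) (hu : ‖u‖ = 1) (i : Fin (p + 1))
    (j : Fin p) : cov[fun x => otherCoords i x j, regResidual θ u i; spikedRow θ u] = 0 := by
  rw [regResidual_eq_dotProduct, otherCoords_eq_dotProduct, covariance_dotProduct_spikedRow hθ,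
    single_dotProduct, single_dotProduct, dotProduct_comm _ (u : Fin (p + 1) → ℝ),
    dotProduct_insertNth, Fin.insertNth_apply_succAbove, dotProduct_neg,
    dotProduct_comm _ (regCoef θ u i), regCoef_dotProduct_succAbove hu, Pi.neg_apply, regCoef]
  have h_denom := (regDenom_pos hθ hu i).ne'
  field_simp
  ring

lemma indepFun_otherCoords_regResidual (hθ : 0 ≤ θ) (hu : ‖u‖ = 1) (i : Fin (p + 1)) :
    IndepFun (otherCoords i) (regResidual θ u i) (spikedRow θ u) := by
  let L : EuclideanSpace ℝ (Fin (p + 1)) →L[ℝ] (Fin p → ℝ) × (Unit → ℝ) :=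
    (ContinuousLinearMap.pi fun j => EuclideanSpace.proj (i.succAbove j)).prod
      (ContinuousLinearMap.pi fun _ => EuclideanSpace.proj i -
        ∑ j, regCoef θ u i j • EuclideanSpace.proj (i.succAbove j))
  have h_lin : (fun x => L x) =
      fun x => (fun j => otherCoords i x j, fun _ : Unit => regResidual θ u i x) := by
    ext x j
    · rfl
    · simp [L, regResidual, otherCoords, dotProduct, mul_comm]
  have h_gauss : HasGaussianLaw (fun x => (fun j => otherCoords i x j,
      fun _ : Unit => regResidual θ u i x)) (spikedRow θ u) :=
    h_lin ▸ (IsGaussian.hasGaussianLaw_id (μ := spikedRow θ u)).map_fun L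
  have h_indep := h_gauss.indepFun_of_covariance_eval (X := fun j x => otherCoords i x j)
    (Y := fun _ x => regResidual θ u i x) fun j _ =>
      covariance_otherCoords_regResidual hθ hu i j
  exact h_indep.comp (φ := id) (ψ := fun f : Unit → ℝ => f ()) measurable_id (by fun_prop)

lemma map_otherCoords_regResidual (n : ℕ) (hθ : 0 ≤ θ) (hu : ‖u‖ = 1) (i : Fin (p + 1))
    {σ : ℝ≥0} (hσ : (σ : ℝ) ^ 2 = regVar θ u i) :
    (spikedLaw n θ u).map (fun x => (fun t => otherCoords i (x t),
      fun t => regResidual θ u i (x t))) =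
      ((spikedLaw n θ u).map fun x t => otherCoords i (x t)).prod (noiseLaw n σ) := by
  have h_residual : (spikedRow θ u).map (regResidual θ u i) = gaussianReal 0 (σ ^ 2) := by
    rw [regResidual_eq_dotProduct]
    exact map_dotProduct_spikedRow hθ _ (hσ.trans (spikedVar_insertNth_neg_regCoef hθ hu i).symm)
  have h_others : (spikedLaw n θ u).map (fun x t => otherCoords i (x t)) =
      Measure.pi fun _ => (spikedRow θ u).map (otherCoords i) := by
    have := Measure.isProbabilityMeasure_map (μ := spikedRow θ u)
      (measurable_otherCoords i).aemeasurable
    exact Measure.pi_map_pi (f := fun _ => otherCoords i) fun _ => by fun_prop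
  rw [h_others, noiseLaw, ← h_residual, spikedLaw_eq_pi_spikedRow]
  exact pi_map_prodMk_of_indepFun (by fun_prop) (by fun_prop)
    (indepFun_otherCoords_regResidual hθ hu i) n

end Regression

/-! ### The statistic of one coordinate under the spiked covariance model -/

section Statistic

variable {n p k : ℕ} {slr : SLRSolver}

lemma qStat_dataMatrix (slr : SLRSolver) (k : ℕ) (θ : ℝ) (u : Fin (p + 1) → ℝ) (i : Fin (p + 1))
    (x : Fin n → EuclideanSpace ℝ (Fin (p + 1))) :
    qStat slr (dataMatrix x) k i = fitGain slr (dropCol (dataMatrix x) i) k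
      (dropCol (dataMatrix x) i *ᵥ regCoef θ u i + fun t => regResidual θ u i (x t)) := by
  have h_col : (dataMatrix x).col i =
      dropCol (dataMatrix x) i *ᵥ regCoef θ u i + fun t => regResidual θ u i (x t) := by
    ext t
    exact (add_sub_cancel (otherCoords i (x t) ⬝ᵥ regCoef θ u i) (x t i)).symm
  rw [qStat, fitGain, h_col]

lemma measurable_fitGain_mulVec_add (hm : slr.IsMeasurable) (k : ℕ) (b : Fin p → ℝ) :
    Measurable fun q : (Fin n → Fin p → ℝ) × (Fin n → ℝ) =>
      fitGain slr (Matrix.of q.1) k (Matrix.of q.1 *ᵥ b + q.2) := by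
  have h_design : ∀ t j, Measurable fun q : (Fin n → Fin p → ℝ) × (Fin n → ℝ) =>
      Matrix.of q.1 t j := fun t j => by
    simp only [Matrix.of_apply]
    fun_prop
  have h_response : Measurable fun q : (Fin n → Fin p → ℝ) × (Fin n → ℝ) =>
      Matrix.of q.1 *ᵥ b + q.2 :=
    (measurable_mulVec h_design measurable_const).add measurable_snd
  have h_fit := measurable_mulVec h_design (hm.measurable_apply (k := k) h_response h_design)
  exact ((measurable_sqNorm.comp h_response).div_const _).sub
    ((measurable_sqNorm.comp (h_response.sub h_fit)).div_const _)

/-- The designs with well-conditioned restricted eigenvalues (in the form of finitely many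
inequalities) and with a signal `‖Zb‖²` of at least half its expected size `n τ`. -/
def goodDesigns (n k : ℕ) (b : Fin p → ℝ) (τ : ℝ) : Set (Fin n → Fin p → ℝ) :=
  {Z | (∀ J : Fin (512 * k + 1) → Fin p × Bool,
      n / 2 * sqNorm (signedSum J) ≤ sqNorm (Matrix.of Z *ᵥ signedSum J)) ∧
    (∀ j, sqNorm (Matrix.of Z *ᵥ Pi.single j 1) ≤ 8 * n) ∧
    n / 2 * τ ≤ sqNorm (Matrix.of Z *ᵥ b)}

lemma measurableSet_goodDesigns (n k : ℕ) (b : Fin p → ℝ) (τ : ℝ) :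
    MeasurableSet (goodDesigns n k b τ) := by
  have h_meas : ∀ v : Fin p → ℝ, Measurable fun Z : Fin n → Fin p → ℝ =>
      sqNorm (Matrix.of Z *ᵥ v) := fun v =>
    measurable_sqNorm.comp (measurable_mulVec
      (fun t j => by simp only [Matrix.of_apply]; fun_prop) measurable_const)
  simp only [goodDesigns, Set.ofPred_and, Set.ofPred_forall]
  exact (MeasurableSet.iInter fun _ => measurableSet_le measurable_const (h_meas _)).inter
    ((MeasurableSet.iInter fun _ => measurableSet_le (h_meas _) measurable_const).inter
      (measurableSet_le measurable_const (h_meas _)))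

lemma quarter_le_reConst_of_mem_goodDesigns (hn : 1 ≤ n) (hk : 1 ≤ k) (hkp : k ≤ p)
    {b : Fin p → ℝ} {τ : ℝ} {Z : Fin n → Fin p → ℝ} (hZ : Z ∈ goodDesigns n k b τ) :
    1 / 4 ≤ reConst (Matrix.of Z) k := by
  have hn0 : (0 : ℝ) < n := by exact_mod_cast hn
  refine quarter_le_reConst hk hkp (fun J => ?_) fun j => ?_
  · rw [le_div_iff₀ hn0]
    linarith [hZ.1 J]
  · rw [div_le_iff₀ hn0, ← Matrix.mulVec_single_one]
    exact hZ.2.1 j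

/-- The variance `θ² uᵢ² (1 - uᵢ²) / (1 + θ (1 - uᵢ²))` of the regression of coordinate `i` on the
other coordinates: the strength of the signal seen by the solver. -/
noncomputable def signalVar (θ : ℝ) (u : Fin (p + 1) → ℝ) (i : Fin (p + 1)) : ℝ :=
  θ ^ 2 * (u i ^ 2 * (1 - u i ^ 2)) / (1 + θ * (1 - u i ^ 2))

lemma dropCol_dataMatrix_mulVec (x : Fin n → EuclideanSpace ℝ (Fin (p + 1))) (i : Fin (p + 1))
    (v : Fin p → ℝ) :
    dropCol (dataMatrix x) i *ᵥ v = dataMatrix x *ᵥ (i.insertNth 0 v : Fin (p + 1) → ℝ) := by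
  ext t
  rw [Matrix.mulVec, Matrix.mulVec, dotProduct_insertNth, mul_zero, zero_add]
  rfl

variable {θ : ℝ} {u : EuclideanSpace ℝ (Fin (p + 1))}

lemma spikedVar_insertNth_zero (i : Fin (p + 1)) (v : Fin p → ℝ) :
    spikedVar θ u (i.insertNth 0 v) =
      v ⬝ᵥ v + θ * (v ⬝ᵥ fun j => u (i.succAbove j)) ^ 2 := by
  rw [spikedVar, dotProduct_insertNth, dotProduct_comm _ (u : Fin (p + 1) → ℝ),
    dotProduct_insertNth, dotProduct_comm v fun j => u (i.succAbove j)]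
  simp only [Fin.insertNth_apply_succAbove, mul_zero, zero_add]

lemma spikedVar_insertNth_regCoef (hθ : 0 ≤ θ) (hu : ‖u‖ = 1) (i : Fin (p + 1)) :
    spikedVar θ u (i.insertNth 0 (regCoef θ u i)) = signalVar θ u i := by
  have h_denom := (regDenom_pos hθ hu i).ne'
  rw [spikedVar_insertNth_zero, regCoef_dotProduct_self hu, regCoef_dotProduct_succAbove hu,
    signalVar]
  field_simp

lemma sqNorm_le_spikedVar_insertNth_zero (hθ : 0 ≤ θ) (i : Fin (p + 1)) (v : Fin p → ℝ) :
    sqNorm v ≤ spikedVar θ u (i.insertNth 0 v) := by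
  rw [spikedVar_insertNth_zero, sqNorm]
  simp only [pow_two (v _)]
  exact le_add_of_nonneg_right (mul_nonneg hθ (sq_nonneg _))

lemma spikedVar_insertNth_single_le (hθ1 : θ ≤ 1) (hu : ‖u‖ = 1) (i : Fin (p + 1)) (j : Fin p) :
    spikedVar θ u (i.insertNth 0 (Pi.single j 1)) ≤ 2 := by
  rw [spikedVar_insertNth_zero, single_dotProduct, single_dotProduct, Pi.single_eq_same]
  linarith [mul_le_one₀ hθ1 (sq_nonneg (u (i.succAbove j))) (sq_apply_le_one hu _)]

lemma spikedLaw_sqNorm_dropCol_mulVec_lt_le (n : ℕ) (hθ : 0 ≤ θ) (i : Fin (p + 1))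
    (v : Fin p → ℝ) {τ : ℝ} (hτ : τ ≤ spikedVar θ u (i.insertNth 0 v)) :
    (spikedLaw n θ u).real {x | sqNorm (dropCol (dataMatrix x) i *ᵥ v) < n / 2 * τ} ≤
      Real.exp (-(n / 12)) := by
  refine (measureReal_mono fun x hx => ?_).trans
    (spikedLaw_sqNorm_mulVec_lt_le n hθ (i.insertNth 0 v))
  rw [Set.mem_ofPred_eq, dropCol_dataMatrix_mulVec] at hx
  exact hx.trans_le (by gcongr)

lemma spikedLaw_sqNorm_dropCol_mulVec_single_gt_le (n : ℕ) (hθ : 0 ≤ θ) (hθ1 : θ ≤ 1)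
    (hu : ‖u‖ = 1) (i : Fin (p + 1)) (j : Fin p) :
    (spikedLaw n θ u).real
      {x | 8 * n < sqNorm (dropCol (dataMatrix x) i *ᵥ Pi.single j 1)} ≤
      Real.exp (-(n / 12)) := by
  refine (measureReal_mono fun x hx => ?_).trans
    (spikedLaw_sqNorm_mulVec_gt_le n hθ (i.insertNth 0 (Pi.single j 1)))
  rw [Set.mem_ofPred_eq, dropCol_dataMatrix_mulVec] at hx
  refine lt_of_le_of_lt ?_ hx
  calc 4 * n * spikedVar θ u (i.insertNth 0 (Pi.single j 1)) ≤ 4 * n * 2 := by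
        gcongr
        exact spikedVar_insertNth_single_le hθ1 hu i j
    _ = 8 * n := by ring

lemma spikedLaw_notMem_goodDesigns_le (n k : ℕ) (hθ : 0 ≤ θ) (hθ1 : θ ≤ 1) (hu : ‖u‖ = 1)
    (i : Fin (p + 1)) {b : Fin p → ℝ} {τ : ℝ} (hτ : τ ≤ spikedVar θ u (i.insertNth 0 b)) :
    (spikedLaw n θ u).real {x | (fun t => otherCoords i (x t)) ∉ goodDesigns n k b τ} ≤
      ((2 * p) ^ (512 * k + 1) + p + 1) * Real.exp (-(n / 12)) := by
  have h_sub : {x : Fin n → EuclideanSpace ℝ (Fin (p + 1)) |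
      (fun t => otherCoords i (x t)) ∉ goodDesigns n k b τ} ⊆
      (⋃ J : Fin (512 * k + 1) → Fin p × Bool,
        {x | sqNorm (dropCol (dataMatrix x) i *ᵥ signedSum J) <
          n / 2 * sqNorm (signedSum J)}) ∪
      ((⋃ j, {x | 8 * n < sqNorm (dropCol (dataMatrix x) i *ᵥ Pi.single j 1)}) ∪
        {x | sqNorm (dropCol (dataMatrix x) i *ᵥ b) < n / 2 * τ}) := by
    intro x hx
    simp only [Set.mem_ofPred_eq, goodDesigns, not_and_or, not_forall, not_le] at hx
    simp only [Set.mem_union, Set.mem_iUnion, Set.mem_ofPred_eq]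
    exact hx
  have h_net := (measureReal_iUnion_fintype_le _).trans <| Finset.sum_le_card_nsmul Finset.univ
    _ _ fun (J : Fin (512 * k + 1) → Fin p × Bool) _ =>
      spikedLaw_sqNorm_dropCol_mulVec_lt_le (u := u) n hθ i (signedSum J)
        (sqNorm_le_spikedVar_insertNth_zero hθ i _)
  have h_col := (measureReal_iUnion_fintype_le _).trans <| Finset.sum_le_card_nsmul Finset.univ
    _ _ fun (j : Fin p) _ => spikedLaw_sqNorm_dropCol_mulVec_single_gt_le n hθ hθ1 hu i j
  simp only [Finset.card_univ, Fintype.card_pi, Fintype.card_prod, Fintype.card_fin,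
    Fintype.card_bool, Finset.prod_const, nsmul_eq_mul, Nat.cast_pow, Nat.cast_mul,
    Nat.cast_ofNat] at h_net h_col
  refine (measureReal_mono h_sub).trans <| (measureReal_union_le _ _).trans <|
    (add_le_add h_net <| (measureReal_union_le _ _).trans <|
      add_le_add h_col (spikedLaw_sqNorm_dropCol_mulVec_lt_le n hθ i b hτ)).trans_eq ?_
  ring

/- Given the other columns, the residual is a fresh Gaussian noise vector, so the solver faces a
fixed design. -/
lemma spikedLaw_le_of_fixed_design (hθ : 0 ≤ θ) (hu : ‖u‖ = 1) (i : Fin (p + 1)) {σ : ℝ≥0}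
    (hσ : (σ : ℝ) ^ 2 = regVar θ u i) {bad : Set ((Fin n → Fin p → ℝ) × (Fin n → ℝ))}
    (hbad : MeasurableSet bad) {good : Set (Fin n → Fin p → ℝ)} (hgood : MeasurableSet good)
    {δ : ℝ} (hδ : 0 ≤ δ) (h : ∀ Z ∈ good, (noiseLaw n σ).real {w | (Z, w) ∈ bad} ≤ δ) :
    (spikedLaw n θ u).real
      {x | (fun t => otherCoords i (x t), fun t => regResidual θ u i (x t)) ∈ bad} ≤
      (spikedLaw n θ u).real {x | (fun t => otherCoords i (x t)) ∉ good} + δ := by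
  have h_design : Measurable fun (x : Fin n → EuclideanSpace ℝ (Fin (p + 1))) t =>
      otherCoords i (x t) := by fun_prop
  have := Measure.isProbabilityMeasure_map (μ := spikedLaw n θ u) h_design.aemeasurable
  have h_prod := prod_measureReal_le_of_forall_mem
    (ν := (spikedLaw n θ u).map fun x t => otherCoords i (x t)) hbad hgood hδ h
  rwa [← map_otherCoords_regResidual n hθ hu i hσ, map_measureReal_apply (by fun_prop) hbad,
    map_measureReal_apply h_design hgood.compl] at h_prod

lemma spikedLaw_qStat_gt_le (hm : slr.IsMeasurable)
    (hs : ∀ (n p k : ℕ) (y : Fin n → ℝ) (X : Matrix (Fin n) (Fin p) ℝ), IsSparse k (slr n p y X k))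
    (hn : 1 ≤ n) (hk : 1 ≤ k) (hkp : k ≤ p) {L : ℝ} (hL : 1 ≤ L) (hp : (p : ℝ) / k ≤ Real.exp L)
    (hθ : 0 ≤ θ) (hu : ‖u‖ = 1) {i : Fin (p + 1)} (hi : u i = 0) :
    (spikedLaw n θ u).real {x | 13 * k * L / n < qStat slr (dataMatrix x) k i} ≤
      Real.exp (-(3 / 2 * k * L)) := by
  have h_coef : regCoef θ u i = 0 := by
    ext j
    simp [regCoef, hi]
  have h_fixed := spikedLaw_le_of_fixed_design (n := n) hθ hu i (σ := 1)
    (by simp [regVar, hi])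
    (measurableSet_lt (measurable_const (a := 13 * (k : ℝ) * L / n))
      (measurable_fitGain_mulVec_add hm k (regCoef θ u i)))
    MeasurableSet.univ (Real.exp_nonneg _) fun Z _ => by
      simpa [h_coef] using noiseLaw_fitGain_gt_le hs hn hk hkp hL hp (Matrix.of Z)
  simp only [qStat_dataMatrix slr k θ u i]
  refine h_fixed.trans_eq ?_
  simp

lemma IsSparse.regCoef (hu : IsSparse k u) (θ : ℝ) (i : Fin (p + 1)) :
    IsSparse k (regCoef θ u i) := by
  refine (Finset.card_le_card_of_injOn i.succAbove (fun j hj => ?_)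
    i.succAbove_right_injective.injOn).trans hu
  simp only [Finset.mem_coe, mem_suppF] at hj ⊢
  exact right_ne_zero_of_mul hj

lemma one_le_regVar (hθ : 0 ≤ θ) (hu : ‖u‖ = 1) (i : Fin (p + 1)) : 1 ≤ regVar θ u i :=
  le_add_of_nonneg_right
    (div_nonneg (mul_nonneg hθ (sq_nonneg _)) (regDenom_pos hθ hu i).le)

lemma regVar_le_two (hθ : 0 ≤ θ) (hθ1 : θ ≤ 1) (hu : ‖u‖ = 1) (i : Fin (p + 1)) :
    regVar θ u i ≤ 2 := by
  have h_sq := sq_apply_le_one hu i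
  have h_frac : θ * u i ^ 2 / (1 + θ * (1 - u i ^ 2)) ≤ 1 := by
    rw [div_le_one (regDenom_pos hθ hu i)]
    linarith [mul_le_one₀ hθ1 (sq_nonneg (u i)) h_sq, mul_nonneg hθ (sub_nonneg.2 h_sq)]
  rw [regVar]
  linarith

lemma spikedLaw_qStat_le_le {c c' c'' : ℝ} (hc : 0 < c) (hc' : 0 < c') (hm : slr.IsMeasurable)
    (hs : slr.BlackBox c c' c'') (hn : 1 ≤ n) (hp : 2 ≤ p) (hk : 1 ≤ k) (hkp : k ≤ p) {ℓ : ℝ}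
    (hℓ : 1 ≤ ℓ) (hpℓ : Real.log p ≤ ℓ) (hθ : 0 ≤ θ) (hθ1 : θ ≤ 1) (hu : ‖u‖ = 1)
    (husp : IsSparse k u) {i : Fin (p + 1)}
    (hsig : (220 + 128 * c) * (k * ℓ) ≤ n / 2 * signalVar θ u i) :
    (spikedLaw n θ u).real {x | qStat slr (dataMatrix x) k i ≤ 13 * (k * ℓ) / n} ≤
      ((2 * p) ^ (512 * k + 1) + p + 1) * Real.exp (-(n / 12)) +
      (c' * Real.exp (-c'' * k * Real.log p) + Real.exp (-(4 * k * ℓ))) := by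
  have h_var := spikedVar_insertNth_neg_regCoef hθ hu i
  obtain ⟨σ, hσ⟩ := exists_sq_eq_spikedVar (u := u) hθ (i.insertNth 1 (-regCoef θ u i))
  rw [h_var] at hσ
  have hσ0 : 0 < σ := by
    by_contra! h_zero
    have h_one := one_le_regVar hθ hu i
    rw [← hσ, nonpos_iff_eq_zero.1 h_zero] at h_one
    norm_num at h_one
  have h_fixed := spikedLaw_le_of_fixed_design (n := n) hθ hu i hσ
    (measurableSet_le (measurable_fitGain_mulVec_add hm k (regCoef θ u i))
      (measurable_const (a := 13 * ((k : ℝ) * ℓ) / n)))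
    (measurableSet_goodDesigns n k (regCoef θ u i) (signalVar θ u i))
    (by positivity) fun Z hZ =>
      noiseLaw_fitGain_le_le hs hm hc hn hp hk hkp hℓ hpℓ
        (quarter_le_reConst_of_mem_goodDesigns hn hk hkp hZ) (husp.regCoef θ i)
        (hsig.trans hZ.2.2) hσ0 (hσ.trans_le (regVar_le_two hθ hθ1 hu i))
  simp only [qStat_dataMatrix slr k θ u i]
  exact h_fixed.trans (add_le_add_left (spikedLaw_notMem_goodDesigns_le n k hθ hθ1 hu i
    (spikedVar_insertNth_regCoef hθ hu i).ge) _)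

end Statistic

/-! ### Consequences of the assumptions on the spike -/

section Spike

variable {p k : ℕ} {u : EuclideanSpace ℝ (Fin (p + 1))} {cmin θ : ℝ} {i : Fin (p + 1)}

lemma sparsity_pos (hu : ‖u‖ = 1) (husp : IsSparse k u) : 1 ≤ k := by
  obtain ⟨i, hi⟩ : ∃ i, u i ≠ 0 := by
    by_contra! h_zero
    have h_norm := EuclideanSpace.real_norm_sq_eq u
    simp [hu, h_zero] at h_norm
  exact (Finset.card_pos.2 ⟨i, mem_suppF.2 hi⟩).trans_le husp

lemma two_le_sparsity (hu : ‖u‖ = 1) (husp : IsSparse k u) (hc : 0 < cmin)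
    (hspread : SpikeSpread k cmin u) : 2 ≤ k := by
  have hk : (0 : ℝ) < k := by exact_mod_cast sparsity_pos hu husp
  have h_mass : 0 < cmin ^ 2 / k := by positivity
  obtain ⟨i, h_lower, h_upper⟩ := hspread
  have h_rest : ∑ j, u (i.succAbove j) ^ 2 ≠ 0 := by
    rw [sum_sq_succAbove hu i]
    linarith
  obtain ⟨j, -, hj⟩ := Finset.exists_ne_zero_of_sum_ne_zero h_rest
  have h_pair : {i, i.succAbove j} ⊆ suppF u := by
    simp only [Finset.insert_subset_iff, Finset.singleton_subset_iff, mem_suppF]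
    exact ⟨pow_ne_zero_iff two_ne_zero |>.1 (h_mass.trans_le h_lower).ne',
      pow_ne_zero_iff two_ne_zero |>.1 hj⟩
  rw [← Finset.card_pair (Fin.succAbove_ne i j).symm]
  exact (Finset.card_le_card h_pair).trans husp

lemma half_cmin_sq_le (hu : ‖u‖ = 1) (husp : IsSparse k u) (hc : 0 < cmin)
    (hspread : SpikeSpread k cmin u) (hmin : SpikeMin k cmin u) (hi : u i ≠ 0) :
    cmin ^ 2 / k / 2 ≤ u i ^ 2 * (1 - u i ^ 2) := by
  have hk : (0 : ℝ) < k := by exact_mod_cast sparsity_pos hu husp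
  have h_mass : 0 < cmin ^ 2 / k := by positivity
  have h_lower : cmin ^ 2 / k ≤ u i ^ 2 := by
    have h_sq := pow_le_pow_left₀ (by positivity) (hmin i hi) 2
    rwa [div_pow, Real.sq_sqrt hk.le, sq_abs] at h_sq
  have h_upper : cmin ^ 2 / k ≤ 1 - u i ^ 2 := by
    obtain ⟨l, hl_lower, hl_upper⟩ := hspread
    by_cases hil : l = i
    · rw [← hil]
      linarith
    · obtain ⟨j, rfl⟩ := Fin.exists_succAbove_eq hil
      rw [← sum_sq_succAbove hu i]
      exact hl_lower.trans (Finset.single_le_sum (f := fun j => u (i.succAbove j) ^ 2)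
        (fun _ _ => sq_nonneg _) (Finset.mem_univ j))
  -- `t (1 - t)` is least at an end point of `[a, 1 - a]`, where it is `a (1 - a) ≥ a / 2`
  nlinarith [mul_nonneg (sub_nonneg.2 h_lower) (sub_nonneg.2 h_upper)]

lemma le_signalVar (hθ : 0 ≤ θ) (hθ1 : θ ≤ 1) (hu : ‖u‖ = 1) (husp : IsSparse k u)
    (hc : 0 < cmin) (hspread : SpikeSpread k cmin u) (hmin : SpikeMin k cmin u) (hi : u i ≠ 0) :
    θ ^ 2 * (cmin ^ 2 / k) / 4 ≤ signalVar θ u i := by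
  have h_denom : 1 + θ * (1 - u i ^ 2) ≤ 2 := by
    linarith [mul_le_one₀ hθ1 (sub_nonneg.2 (sq_apply_le_one hu i))
      (sub_le_self 1 (sq_nonneg (u i)))]
  calc θ ^ 2 * (cmin ^ 2 / k) / 4 = θ ^ 2 * (cmin ^ 2 / k / 2) / 2 := by ring
    _ ≤ signalVar θ u i := by
      rw [signalVar]
      have h_spike := half_cmin_sq_le hu husp hc hspread hmin hi
      have h_pos := regDenom_pos hθ hu i
      gcongr
      exact mul_nonneg (sq_nonneg _) ((by positivity : 0 ≤ cmin ^ 2 / k / 2).trans h_spike)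

lemma le_half_mul_signalVar {n c ℓ : ℝ} (hn : 0 < n) (hθ : 0 ≤ θ) (hθ1 : θ ≤ 1) (hu : ‖u‖ = 1)
    (husp : IsSparse k u) (hc : 0 < cmin) (hspread : SpikeSpread k cmin u)
    (hmin : SpikeMin k cmin u) (hi : u i ≠ 0)
    (hsig : 8 * c / cmin ^ 2 * ((k : ℝ) ^ 2 * ℓ / n) ≤ θ ^ 2) :
    c * (k * ℓ) ≤ n / 2 * signalVar θ u i := by
  have hk : (0 : ℝ) < k := by exact_mod_cast sparsity_pos hu husp
  calc c * (k * ℓ)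
      = n / 2 * (8 * c / cmin ^ 2 * ((k : ℝ) ^ 2 * ℓ / n) * (cmin ^ 2 / k) / 4) := by
        field_simp
        ring
    _ ≤ n / 2 * (θ ^ 2 * (cmin ^ 2 / k) / 4) := by gcongr
    _ ≤ n / 2 * signalVar θ u i := by
        gcongr
        exact le_signalVar hθ hθ1 hu husp hc hspread hmin hi

end Spike

/-! ### Numerical estimates -/

lemma log_le_mul_log_div {d k : ℝ} (hk : 2 ≤ k) (hd : Real.exp 1 * k ≤ d) :
    Real.log d ≤ k * Real.log (d / k) := by
  have hk0 : 0 < k := by linarith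
  have hd0 : 0 < d := lt_of_lt_of_le (by positivity) hd
  have h_log : 1 + Real.log k ≤ Real.log d := by
    rw [← Real.log_exp 1, ← Real.log_mul (Real.exp_pos 1).ne' hk0.ne']
    exact Real.log_le_log (by positivity) hd
  rw [Real.log_div hd0.ne' hk0.ne']
  nlinarith [Real.log_le_sub_one_of_pos hk0]

lemma mul_log_le_log_div {d k ε : ℝ} (hk : 0 < k) (hd : 0 < d) (hkd : k ≤ d ^ (1 - ε)) :
    ε * Real.log d ≤ Real.log (d / k) := by
  have h_log := Real.log_le_log hk hkd
  rw [Real.log_rpow hd] at h_log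
  rw [Real.log_div hd.ne' hk.ne']
  linarith

lemma two_mul_pow_add_le_exp {p k : ℕ} {ℓ : ℝ} (hk : 1 ≤ k) (hp : 2 ≤ p) (hℓ : 1 ≤ ℓ)
    (hd : (p + 1 : ℝ) = Real.exp ℓ) :
    (2 * p : ℝ) ^ (512 * k + 1) + p + 1 ≤ Real.exp (1030 * k * ℓ) := by
  have hk1 : (1 : ℝ) ≤ k := by exact_mod_cast hk
  have hkℓ : ℓ ≤ k * ℓ := le_mul_of_one_le_left (by linarith) hk1
  have h_base : (2 * p : ℝ) ≤ Real.exp ℓ ^ 2 := by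
    rw [← hd]
    nlinarith [(Nat.cast_le (α := ℝ)).2 hp]
  have h_two : (2 : ℝ) ≤ Real.exp 1 := by linarith [Real.exp_one_gt_d9]
  calc (2 * p : ℝ) ^ (512 * k + 1) + p + 1
      = (2 * p : ℝ) ^ (512 * k + 1) + Real.exp ℓ := by rw [← hd, add_assoc]
    _ ≤ (Real.exp ℓ ^ 2) ^ (512 * k + 1) + Real.exp ℓ := by gcongr
    _ = Real.exp ((1024 * k + 2) * ℓ) + Real.exp ℓ := by
        rw [← pow_mul, ← Real.exp_nat_mul]
        push_cast
        ring_nf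
    _ ≤ Real.exp (1029 * k * ℓ) + Real.exp (1029 * k * ℓ) := by
        gcongr <;> linarith
    _ ≤ Real.exp 1 * Real.exp (1029 * k * ℓ) := by
        rw [← two_mul]
        gcongr
    _ = Real.exp (1 + 1029 * k * ℓ) := (Real.exp_add _ _).symm
    _ ≤ Real.exp (1030 * k * ℓ) := by
        gcongr
        linarith

lemma two_mul_pow_add_mul_exp_le {p k : ℕ} {n ℓ : ℝ} (hk : 1 ≤ k) (hp : 2 ≤ p) (hℓ : 1 ≤ ℓ)
    (hd : (p + 1 : ℝ) = Real.exp ℓ) (hn : 12 * 1034 * k * ℓ ≤ n) :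
    ((2 * p) ^ (512 * k + 1) + p + 1) * Real.exp (-(n / 12)) ≤ Real.exp (-(4 * k * ℓ)) := by
  calc ((2 * p) ^ (512 * k + 1) + p + 1) * Real.exp (-(n / 12))
      ≤ Real.exp (1030 * k * ℓ) * Real.exp (-(n / 12)) := by
        gcongr
        exact two_mul_pow_add_le_exp hk hp hℓ hd
    _ = Real.exp (1030 * k * ℓ - n / 12) := by rw [← Real.exp_add, sub_eq_add_neg]
    _ ≤ Real.exp (-(4 * k * ℓ)) := by
        gcongr
        linarith

lemma mul_exp_neg_le {a x y : ℝ} (ha : 0 < a) (hxy : x ≤ y) :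
    x * Real.exp (-(2 * a * y)) ≤ a⁻¹ * Real.exp (-(a * y)) := by
  have h_exp : a * x ≤ Real.exp (a * y) := by
    linarith [Real.add_one_le_exp (a * y), mul_le_mul_of_nonneg_left hxy ha.le]
  calc x * Real.exp (-(2 * a * y)) = a⁻¹ * (a * x) * Real.exp (-(2 * a * y)) := by
        rw [inv_mul_cancel_left₀ ha.ne']
    _ ≤ a⁻¹ * Real.exp (a * y) * Real.exp (-(2 * a * y)) := by gcongr
    _ = a⁻¹ * Real.exp (-(a * y)) := by
        rw [mul_assoc, ← Real.exp_add]
        ring_nf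

lemma log_add_one_le_two_mul_log {x : ℝ} (hx : 2 ≤ x) : Real.log (x + 1) ≤ 2 * Real.log x := by
  have h_sq := Real.log_le_log (by linarith) (by nlinarith : x + 1 ≤ x ^ 2)
  rwa [Real.log_pow, Nat.cast_two] at h_sq

/-! ### Support recovery -/

lemma one_sub_measureReal_compl_le {α : Type*} [MeasurableSpace α] {μ : Measure α}
    [IsProbabilityMeasure μ] (s : Set α) : 1 - μ.real sᶜ ≤ μ.real s := by
  rw [sub_le_iff_le_add, ← probReal_univ (μ := μ), ← Set.union_compl_self s]
  exact measureReal_union_le s sᶜ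

section Recovery

variable {n p k : ℕ} {slr : SLRSolver}

lemma measureReal_qSupport_ne_le {Ω : Type*} [MeasurableSpace Ω] {μ : Measure Ω}
    [IsFiniteMeasure μ] {X : Ω → Matrix (Fin n) (Fin (p + 1)) ℝ} {v : Fin (p + 1) → ℝ}
    (hv : IsSparse k v) {δ₀ δ₁ : ℝ} (hδ₀ : 0 ≤ δ₀) (hδ₁ : 0 ≤ δ₁)
    (h_null : ∀ i, v i = 0 → μ.real {ω | 13 * k * Real.log (((p + 1 : ℕ) : ℝ) / k) / n <
      qStat slr (X ω) k i} ≤ δ₀)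
    (h_signal : ∀ i, v i ≠ 0 → μ.real {ω | qStat slr (X ω) k i ≤
      13 * k * Real.log (((p + 1 : ℕ) : ℝ) / k) / n} ≤ δ₁) :
    μ.real {ω | qSupport slr (X ω) k ≠ suppF v} ≤ (p + 1) * δ₀ + k * δ₁ := by
  have h_sub : {ω | qSupport slr (X ω) k ≠ suppF v} ⊆
      ⋃ i, {ω | ¬(i ∈ qSupport slr (X ω) k ↔ i ∈ suppF v)} := fun ω hω => by
    simpa only [Set.mem_iUnion, Set.mem_ofPred_eq, ne_eq, Finset.ext_iff, not_forall] using hω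
  have h_coord : ∀ i, μ.real {ω | ¬(i ∈ qSupport slr (X ω) k ↔ i ∈ suppF v)} ≤
      δ₀ + if i ∈ suppF v then δ₁ else 0 := fun i => by
    simp only [mem_suppF, qSupport, Finset.mem_filter, Finset.mem_univ, true_and]
    by_cases hi : v i = 0
    · simpa only [hi, ne_eq, not_true_eq_false, iff_false, not_not, if_false, add_zero]
        using h_null i hi
    · simp only [hi, ne_eq, not_false_eq_true, iff_true, not_lt, if_true]
      exact (h_signal i hi).trans (le_add_of_nonneg_left hδ₀)
  calc μ.real {ω | qSupport slr (X ω) k ≠ suppF v}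
      ≤ ∑ i, (δ₀ + if i ∈ suppF v then δ₁ else 0) :=
        (measureReal_mono h_sub).trans <| (measureReal_iUnion_fintype_le _).trans <|
          Finset.sum_le_sum fun i _ => h_coord i
    _ = (p + 1) * δ₀ + (suppF v).card * δ₁ := by
        rw [Finset.sum_add_distrib, Finset.sum_ite_mem, Finset.univ_inter, Finset.sum_const,
          Finset.sum_const, nsmul_eq_mul, nsmul_eq_mul, Finset.card_univ, Fintype.card_fin]
        push_cast
        rfl
    _ ≤ (p + 1) * δ₀ + k * δ₁ := by
        gcongr
        exact hv

/- With `d = exp ℓ` coordinates, the failure probabilities of the coordinates add up to a multiple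
of `exp (- m k L)`. -/
lemma union_bound_le {c' c'' k ℓ L ℓ' m : ℝ} (hc' : 0 < c') (hc'' : 0 < c'') (hk : 1 ≤ k)
    (hL : 1 ≤ L) (hLℓ : L ≤ ℓ) (hℓ : ℓ ≤ k * L) (hℓ' : ℓ ≤ 2 * ℓ') (hm : m ≤ 1 / 2)
    (hmc : m ≤ c'' / 4) :
    Real.exp ℓ * Real.exp (-(3 / 2 * k * L)) +
      k * (Real.exp (-(4 * k * ℓ)) + (c' * Real.exp (-c'' * k * ℓ') + Real.exp (-(4 * k * ℓ)))) ≤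
    (3 + c' * (4 / c'')) * Real.exp (-(m * k * L)) := by
  have hk0 : 0 < k := by linarith
  have hk_le : k ≤ k * L := le_mul_of_one_le_right hk0.le hL
  have hkL_le : k * L ≤ k * ℓ := by gcongr
  have h_mul : m * (k * L) ≤ 1 / 2 * (k * L) := by gcongr
  have h_null : Real.exp ℓ * Real.exp (-(3 / 2 * k * L)) ≤ Real.exp (-(m * k * L)) := by
    rw [← Real.exp_add]
    gcongr
    linarith
  have h_design : k * Real.exp (-(4 * k * ℓ)) ≤ Real.exp (-(m * k * L)) := by
    calc k * Real.exp (-(4 * k * ℓ)) ≤ Real.exp (k * L) * Real.exp (-(4 * k * ℓ)) := by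
          gcongr
          linarith [Real.add_one_le_exp (k * L)]
      _ ≤ Real.exp (-(m * k * L)) := by
          rw [← Real.exp_add]
          gcongr
          linarith
  have h_solver : k * Real.exp (-c'' * k * ℓ') ≤ 4 / c'' * Real.exp (-(m * k * L)) := by
    have h_half : c'' * k * L ≤ c'' * k * (2 * ℓ') := by
      gcongr
      exact hLℓ.trans hℓ'
    have h_rate : m * (k * L) ≤ c'' / 4 * (k * L) := by gcongr
    calc k * Real.exp (-c'' * k * ℓ') ≤ k * Real.exp (-(2 * (c'' / 4) * (k * L))) := by
          gcongr
          linarith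
      _ ≤ (c'' / 4)⁻¹ * Real.exp (-(c'' / 4 * (k * L))) := mul_exp_neg_le (by positivity) hk_le
      _ ≤ 4 / c'' * Real.exp (-(m * k * L)) := by
          rw [inv_div]
          gcongr 4 / c'' * Real.exp ?_
          linarith
  have h_solver' := mul_le_mul_of_nonneg_left h_solver hc'.le
  linarith

variable {c c' c'' θ cmin : ℝ} {u : EuclideanSpace ℝ (Fin (p + 1))}

lemma spikedLaw_qStat_le_of_apply_ne_zero (hc : 0 < c) (hc' : 0 < c') (hm : slr.IsMeasurable)
    (hs : slr.BlackBox c c' c'') (hcmin : 0 < cmin) (hu : ‖u‖ = 1) (husp : IsSparse k u)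
    (hspread : SpikeSpread k cmin u) (hmin : SpikeMin k cmin u) (hkp : k ≤ p) {L ℓ : ℝ}
    (hd : (p + 1 : ℝ) = Real.exp ℓ) (hℓ : 1 ≤ ℓ) (hLℓ : L ≤ ℓ) (hθ : 0 ≤ θ) (hθ1 : θ ≤ 1)
    (hsig : 8 * (220 + 128 * c) / cmin ^ 2 * ((k : ℝ) ^ 2 * ℓ / n) ≤ θ ^ 2)
    (hn : 12 * 1034 * k * ℓ ≤ n) {i : Fin (p + 1)} (hi : u i ≠ 0) :
    (spikedLaw n θ u).real {x | qStat slr (dataMatrix x) k i ≤ 13 * k * L / n} ≤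
      Real.exp (-(4 * k * ℓ)) +
        (c' * Real.exp (-c'' * k * Real.log p) + Real.exp (-(4 * k * ℓ))) := by
  have hk2 := two_le_sparsity hu husp hcmin hspread
  have hk0 : (0 : ℝ) < k := by exact_mod_cast zero_lt_two.trans_le hk2
  have hp0 : (0 : ℝ) < p := by exact_mod_cast (zero_lt_two.trans_le hk2).trans_le hkp
  have hn0 : (0 : ℝ) < n := (mul_pos (mul_pos (by norm_num) hk0) (by linarith)).trans_le hn
  have hn1 : 1 ≤ n := by exact_mod_cast hn0
  have hpℓ : Real.log p ≤ ℓ := by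
    rw [Real.log_le_iff_le_exp hp0, ← hd]
    linarith
  calc (spikedLaw n θ u).real {x | qStat slr (dataMatrix x) k i ≤ 13 * k * L / n}
      ≤ (spikedLaw n θ u).real {x | qStat slr (dataMatrix x) k i ≤ 13 * (k * ℓ) / n} := by
        refine measureReal_mono fun x hx => ?_
        rw [Set.mem_ofPred_eq, mul_assoc 13] at hx
        exact hx.trans (by gcongr)
    _ ≤ ((2 * p) ^ (512 * k + 1) + p + 1) * Real.exp (-(n / 12)) +
        (c' * Real.exp (-c'' * k * Real.log p) + Real.exp (-(4 * k * ℓ))) :=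
      spikedLaw_qStat_le_le hc hc' hm hs hn1 (hk2.trans hkp) (by omega) hkp hℓ hpℓ hθ hθ1 hu husp
        (le_half_mul_signalVar hn0 hθ hθ1 hu husp hcmin hspread hmin hi hsig)
    _ ≤ Real.exp (-(4 * k * ℓ)) +
        (c' * Real.exp (-c'' * k * Real.log p) + Real.exp (-(4 * k * ℓ))) := by
      gcongr
      exact two_mul_pow_add_mul_exp_le (by omega) (hk2.trans hkp) hℓ hd hn

lemma le_of_exp_one_mul_le (hk : 1 ≤ k) (hd : Real.exp 1 * k ≤ ((p + 1 : ℕ) : ℝ)) : k ≤ p := by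
  have hk_lt : (k : ℝ) < ((p + 1 : ℕ) : ℝ) :=
    (lt_mul_of_one_lt_left (by exact_mod_cast hk) (by linarith [Real.exp_one_gt_d9])).trans_le hd
  exact Nat.lt_succ_iff.1 (by exact_mod_cast hk_lt)

theorem spikedLaw_qSupport_ne_suppF_le (hc : 0 < c) (hc' : 0 < c') (hc'' : 0 < c'')
    (hm : slr.IsMeasurable) (hs : slr.BlackBox c c' c'') (hcmin : 0 < cmin) (hu : ‖u‖ = 1)
    (husp : IsSparse k u) (hspread : SpikeSpread k cmin u) (hmin : SpikeMin k cmin u)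
    (hd : Real.exp 1 * k ≤ ((p + 1 : ℕ) : ℝ)) (hθ : 0 ≤ θ) (hθ1 : θ ≤ 1)
    (hsig : 8 * (220 + 128 * c) / cmin ^ 2 *
      ((k : ℝ) ^ 2 * Real.log ((p + 1 : ℕ) : ℝ) / n) ≤ θ ^ 2)
    (hn : 12 * 1034 * k * Real.log ((p + 1 : ℕ) : ℝ) ≤ n) :
    (spikedLaw n θ u).real {x | qSupport slr (dataMatrix x) k ≠ suppF u} ≤
      (3 + c' * (4 / c'')) *
        Real.exp (-(min (1 / 2) (c'' / 4) * k * Real.log (((p + 1 : ℕ) : ℝ) / k))) := by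
  have hk2 := two_le_sparsity hu husp hcmin hspread
  have hk2' : (2 : ℝ) ≤ k := by exact_mod_cast hk2
  have hkp : k ≤ p := le_of_exp_one_mul_le (by omega) hd
  have hp2 : (2 : ℝ) ≤ p := hk2'.trans (by exact_mod_cast hkp)
  have h_exp : (p + 1 : ℝ) = Real.exp (Real.log ((p + 1 : ℕ) : ℝ)) := by
    rw [Real.exp_log (by positivity), Nat.cast_succ]
  have hL : 1 ≤ Real.log (((p + 1 : ℕ) : ℝ) / k) := by
    rwa [Real.le_log_iff_exp_le (by positivity), le_div_iff₀ (by positivity)]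
  have hLℓ : Real.log (((p + 1 : ℕ) : ℝ) / k) ≤ Real.log ((p + 1 : ℕ) : ℝ) :=
    Real.log_le_log (by positivity) (div_le_self (by positivity) (by linarith))
  have hn0 : (0 : ℝ) < n := lt_of_lt_of_le
    (mul_pos (by positivity) (zero_lt_one.trans_le (hL.trans hLℓ))) hn
  have hp_exp : (p : ℝ) / k ≤ Real.exp (Real.log (((p + 1 : ℕ) : ℝ) / k)) := by
    rw [Real.exp_log (by positivity), Nat.cast_succ]
    gcongr
    linarith
  have h_union := measureReal_qSupport_ne_le (μ := spikedLaw n θ u) (X := dataMatrix) husp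
    (Real.exp_nonneg _) (by positivity)
    (fun _ => spikedLaw_qStat_gt_le hm hs.1 (by exact_mod_cast hn0) (by omega) hkp hL hp_exp hθ hu)
    (fun _ => spikedLaw_qStat_le_of_apply_ne_zero hc hc' hm hs hcmin hu husp hspread hmin hkp h_exp
      (hL.trans hLℓ) hLℓ hθ hθ1 hsig hn)
  rw [h_exp] at h_union
  refine h_union.trans (union_bound_le hc' hc'' (by linarith) hL hLℓ (log_le_mul_log_div hk2' hd)
    ?_ (min_le_left _ _) (min_le_right _ _))
  rw [Nat.cast_succ]
  exact log_add_one_le_two_mul_log hp2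

end Recovery

/-! ### Hoare triples with running time -/

/-- A Hoare triple with running time: started in a state with property `P`, the program ends in a
state with property `Q` after at most `K` steps. -/
def Prog.Triple (slr : SLRSolver) (T : ℕ → ℕ → ℕ → ℕ) (P : MState → Prop) (c : Prog)
    (Q : MState → Prop) (K : ℕ) : Prop :=
  ∀ s, P s → Q (c.run slr T s).1 ∧ (c.run slr T s).2 ≤ K

section Triple

variable {slr : SLRSolver} {T : ℕ → ℕ → ℕ → ℕ} {P Q R : MState → Prop} {c c₁ c₂ : Prog}
  {K K₁ K₂ : ℕ}

lemma Prog.Triple.mono (h : Prog.Triple slr T P c Q K₁) (hK : K₁ ≤ K₂) :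
    Prog.Triple slr T P c Q K₂ :=
  fun s hs => ⟨(h s hs).1, (h s hs).2.trans hK⟩

lemma Prog.Triple.seq (h₁ : Prog.Triple slr T P c₁ Q K₁) (h₂ : Prog.Triple slr T Q c₂ R K₂) :
    Prog.Triple slr T P (.seq c₁ c₂) R (K₁ + K₂) := fun s hs =>
  have h_mid := h₁ s hs
  have h_end := h₂ _ h_mid.1
  ⟨h_end.1, add_le_add h_mid.2 h_end.2⟩

lemma Prog.Triple.ifIdxLt {e f : IdxExp}
    (h₁ : Prog.Triple slr T (fun s => P s ∧ e.eval s < f.eval s) c₁ Q K)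
    (h₂ : Prog.Triple slr T (fun s => P s ∧ ¬e.eval s < f.eval s) c₂ Q K) :
    Prog.Triple slr T P (.ifIdxLt e f c₁ c₂) Q (K + e.cost + f.cost + 1) := by
  intro s hs
  by_cases h_lt : e.eval s < f.eval s
  · simpa only [Prog.run, if_pos h_lt, add_le_add_iff_right] using h₁ s ⟨hs, h_lt⟩
  · simpa only [Prog.run, if_neg h_lt, add_le_add_iff_right] using h₂ s ⟨hs, h_lt⟩

lemma Prog.Triple.ifRealLt {x y : RealExp}
    (h₁ : Prog.Triple slr T (fun s => P s ∧ x.eval s < y.eval s) c₁ Q K)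
    (h₂ : Prog.Triple slr T (fun s => P s ∧ ¬x.eval s < y.eval s) c₂ Q K) :
    Prog.Triple slr T P (.ifRealLt x y c₁ c₂) Q (K + x.cost + y.cost + 1) := by
  intro s hs
  by_cases h_lt : x.eval s < y.eval s
  · simpa only [Prog.run, if_pos h_lt, add_le_add_iff_right] using h₁ s ⟨hs, h_lt⟩
  · simpa only [Prog.run, if_neg h_lt, add_le_add_iff_right] using h₂ s ⟨hs, h_lt⟩

lemma iterCost_invariant {body : ℕ → MState → MState × ℕ} {I : ℕ → MState → Prop} {M : ℕ}
    (h : ∀ m < M, ∀ s, I m s → I (m + 1) (body m s).1 ∧ (body m s).2 ≤ K) {s : MState}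
    (hs : I 0 s) : I M (iterCost body M s).1 ∧ (iterCost body M s).2 ≤ M * (K + 1) := by
  induction M with
  | zero => exact ⟨hs, by simp [iterCost]⟩
  | succ M ih =>
    obtain ⟨h_inv, h_cost⟩ := ih fun m hm => h m (hm.trans M.lt_succ_self)
    obtain ⟨h_inv', h_cost'⟩ := h M M.lt_succ_self _ h_inv
    refine ⟨h_inv', ?_⟩
    simp only [iterCost]
    linarith

lemma Prog.Triple.loop {r M : ℕ} {e : IdxExp} {I : ℕ → MState → Prop}
    (he : ∀ s, I 0 s → e.eval s = M) (hI : ∀ m x s, I m s → I m (s.setIdx r x))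
    (hc : ∀ m < M, Prog.Triple slr T (fun s => I m s ∧ s.idx r = m) c (I (m + 1)) K) :
    Prog.Triple slr T (I 0) (.loop r e c) (I M) (M * (K + 1) + e.cost + 1) := by
  intro s hs
  have h_iter := iterCost_invariant (body := fun i s' => c.run slr T (s'.setIdx r i))
    (fun m hm s' hs' => hc m hm _ ⟨hI m m s' hs', by simp [MState.setIdx]⟩) hs
  simpa only [Prog.run, he s hs, add_le_add_iff_right] using h_iter

lemma Prog.Triple.setReal {a : ℕ} {e f : IdxExp} {x : RealExp}
    (h : ∀ s, P s → Q (s.setReal a (e.eval s) (f.eval s) (x.eval s))) :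
    Prog.Triple slr T P (.setReal a e f x) Q (e.cost + f.cost + x.cost + 1) :=
  fun s hs => ⟨h s hs, le_rfl⟩

end Triple

section AgreeBelow

variable {s s' : MState} {r q a b : ℕ}

/-- The states have the same registers below `r` and the same arrays below `a`. Invariants mention
only such an initial part of the memory, and working storage lies above it. -/
def MState.AgreeBelow (r a : ℕ) (s s' : MState) : Prop :=
  (∀ q < r, s'.idx q = s.idx q) ∧ ∀ b < a, s'.arr b = s.arr b

lemma MState.AgreeBelow.mono (h : s.AgreeBelow q b s') (hr : r ≤ q) (ha : a ≤ b) :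
    s.AgreeBelow r a s' :=
  ⟨fun _ h_lt => h.1 _ (h_lt.trans_le hr), fun _ h_lt => h.2 _ (h_lt.trans_le ha)⟩

lemma MState.agreeBelow_setIdx (s : MState) (q a x : ℕ) : s.AgreeBelow q a (s.setIdx q x) :=
  ⟨fun _ h_lt => if_neg h_lt.ne, fun _ _ => rfl⟩

lemma MState.agreeBelow_setReal (s : MState) (r b x y : ℕ) (z : ℝ) :
    s.AgreeBelow r b (s.setReal b x y z) :=
  ⟨fun _ _ => rfl, fun _ h_lt => by
    ext
    exact if_neg fun h => h_lt.ne h.1⟩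

lemma MState.agreeBelow_setVec (s : MState) (r b : ℕ) {m : ℕ} (v : Fin m → ℝ) :
    s.AgreeBelow r b (s.setVec b v) :=
  ⟨fun _ _ => rfl, fun _ h_lt => by
    ext
    simp [MState.setVec, h_lt.ne]⟩

end AgreeBelow

/-! ### The program for `Q`-support recovery -/

namespace QRecovery

/- Registers `3`, `4`, `5` hold the coordinate `i`, the row `t` and the column `j`. Arrays `2` and
`3` hold the response and the design of the regression of coordinate `i`, array `4` the answer of
the black box; the entry `(0, 0)` of arrays `5` and `6` accumulates the statistic and the
prediction in one row. -/

/-- Copies the entry `(t, j)` of the design without column `i`. -/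
def copyEntry : Prog :=
  .ifIdxLt (.reg 5) (.reg 3)
    (.setReal 3 (.reg 4) (.reg 5) (.get 0 (.reg 4) (.reg 5)))
    (.setReal 3 (.reg 4) (.reg 5) (.get 0 (.reg 4) (.add (.reg 5) (.const 1))))

/-- Copies row `t` of the response and of the design. -/
def copyRow : Prog :=
  .seq (.setReal 2 (.reg 4) (.const 0) (.get 0 (.reg 4) (.reg 3)))
    (.loop 5 (.sub (.reg 1) (.const 1)) copyEntry)

/-- Adds one term to the inner product of row `t` of the design with the estimate. -/
def addProduct : Prog :=
  .setReal 6 (.const 0) (.const 0) (.add (.get 6 (.const 0) (.const 0))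
    (.mul (.get 3 (.reg 4) (.reg 5)) (.get 4 (.reg 5) (.const 0))))

/-- Adds the contribution of row `t` to `n Qᵢ`. -/
def addRow : Prog :=
  .seq (.setReal 6 (.const 0) (.const 0) (.ofIdx (.const 0)))
    (.seq (.loop 5 (.sub (.reg 1) (.const 1)) addProduct)
      (.setReal 5 (.const 0) (.const 0) (.add (.get 5 (.const 0) (.const 0))
        (.sub (.mul (.get 2 (.reg 4) (.const 0)) (.get 2 (.reg 4) (.const 0)))
          (.mul (.sub (.get 2 (.reg 4) (.const 0)) (.get 6 (.const 0) (.const 0)))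
            (.sub (.get 2 (.reg 4) (.const 0)) (.get 6 (.const 0) (.const 0))))))))

/-- Compares `Qᵢ` with the threshold `13 k log (d / k) / n` and records the result. -/
def decideCoord : Prog :=
  .ifRealLt (.div (.mul (.mul (.ofIdx (.const 13)) (.ofIdx (.reg 2)))
      (.log (.div (.ofIdx (.reg 1)) (.ofIdx (.reg 2))))) (.ofIdx (.reg 0)))
    (.div (.get 5 (.const 0) (.const 0)) (.ofIdx (.reg 0)))
    (.setReal 1 (.reg 3) (.const 0) (.ofIdx (.const 1)))
    (.setReal 1 (.reg 3) (.const 0) (.ofIdx (.const 0)))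

/-- The iteration of the algorithm for coordinate `i`. -/
def coordStep : Prog :=
  .seq (.loop 4 (.reg 0) copyRow)
    (.seq (.callSLR 4 2 3 (.reg 0) (.sub (.reg 1) (.const 1)) (.reg 2))
      (.seq (.setReal 5 (.const 0) (.const 0) (.ofIdx (.const 0)))
        (.seq (.loop 4 (.reg 0) addRow) decideCoord)))

/-- `Q`-support recovery. -/
def program : Prog := .loop 3 (.reg 1) coordStep

section Values

/-- The entry `(t, j)` of the data `D` after deletion of column `i`, on natural-number indices as
in the memory of the machine. -/
def dropEntry (D : ℕ → ℕ → ℝ) (i t j : ℕ) : ℝ := if j < i then D t j else D t (j + 1)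

variable (slr : SLRSolver) (n p k : ℕ) (D : ℕ → ℕ → ℝ)

/-- The estimate returned by the black box for coordinate `i`, extended by `0`. -/
noncomputable def estimate (i j : ℕ) : ℝ :=
  if h : j < p then slr n p (fun t => D t i) (Matrix.of fun t j => dropEntry D i t j) k ⟨j, h⟩
  else 0

/-- The prediction in row `t`, restricted to the first `m` columns. -/
noncomputable def partialPred (i t m : ℕ) : ℝ :=
  ∑ j ∈ Finset.range m, dropEntry D i t j * estimate slr n p k D i j

/-- The contribution of the first `m` rows to `n Qᵢ`. -/
noncomputable def partialStat (i m : ℕ) : ℝ :=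
  ∑ t ∈ Finset.range m, (D t i * D t i -
    (D t i - partialPred slr n p k D i t p) * (D t i - partialPred slr n p k D i t p))

/-- The indicator of the selection of coordinate `i`. -/
noncomputable def decision (i : ℕ) : ℝ :=
  if 13 * k * Real.log ((p + 1 : ℕ) / k) / n < partialStat slr n p k D i n / n then 1 else 0

end Values

section Initial

variable {n p : ℕ} (X : Matrix (Fin n) (Fin (p + 1)) ℝ) (k : ℕ)

lemma initState_arr_zero (t : Fin n) (j : Fin (p + 1)) : (initState X k).arr 0 t j = X t j :=
  dif_pos ⟨rfl, t.2, j.2⟩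

lemma dropEntry_initState (i : Fin (p + 1)) (t : Fin n) (j : Fin p) :
    dropEntry ((initState X k).arr 0) i t j = dropCol X i t j := by
  rw [dropEntry, dropCol, Matrix.submatrix_apply, id, ← initState_arr_zero X k]
  by_cases h_lt : (j : ℕ) < i
  · rw [if_pos h_lt, Fin.succAbove_of_castSucc_lt _ _ h_lt, Fin.val_castSucc]
  · rw [if_neg h_lt, Fin.succAbove_of_le_castSucc _ _ (not_lt.1 h_lt), Fin.val_succ]

lemma estimate_initState (slr : SLRSolver) (i : Fin (p + 1)) (j : Fin p) :
    estimate slr n p k ((initState X k).arr 0) i j = slr n p (X.col i) (dropCol X i) k j := by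
  have h_response : (fun t : Fin n => (initState X k).arr 0 t i) = X.col i :=
    funext fun t => initState_arr_zero X k t i
  have h_design : (Matrix.of fun (t : Fin n) (j : Fin p) =>
      dropEntry ((initState X k).arr 0) i t j) = dropCol X i :=
    Matrix.ext fun t j => dropEntry_initState X k i t j
  rw [estimate, dif_pos j.2, h_response, h_design]

lemma partialPred_initState (slr : SLRSolver) (i : Fin (p + 1)) (t : Fin n) :
    partialPred slr n p k ((initState X k).arr 0) i t p =
      (dropCol X i *ᵥ slr n p (X.col i) (dropCol X i) k) t := by
  rw [partialPred, Finset.sum_range]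
  simp only [estimate_initState, dropEntry_initState]
  rfl

lemma partialStat_initState_div (slr : SLRSolver) (i : Fin (p + 1)) :
    partialStat slr n p k ((initState X k).arr 0) i n / n = qStat slr X k i := by
  rw [partialStat, Finset.sum_range, qStat, ← sub_div, Finset.sum_sub_distrib]
  simp only [partialPred_initState, initState_arr_zero, sqNorm, Matrix.col_apply, Pi.sub_apply,
    pow_two]

end Initial

section Invariants

/-- Registers `0`, `1`, `2` and array `0` hold the input, and array `1` holds the decisions for the
first `i` coordinates. -/
structure Decided (slr : SLRSolver) (n p k : ℕ) (D : ℕ → ℕ → ℝ) (i : ℕ) (s : MState) : Prop where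
  idx0 : s.idx 0 = n
  idx1 : s.idx 1 = p + 1
  idx2 : s.idx 2 = k
  arr0 : s.arr 0 = D
  arr1 : ∀ i' < i, s.arr 1 i' 0 = decision slr n p k D i'

/-- The invariant of the loop over `copyRow`: the first `t` rows have been copied. -/
structure Copied (slr : SLRSolver) (n p k : ℕ) (D : ℕ → ℕ → ℝ) (i t : ℕ) (s : MState) : Prop
    extends Decided slr n p k D i s where
  idx3 : s.idx 3 = i
  arr2 : ∀ t' < t, s.arr 2 t' 0 = D t' i
  arr3 : ∀ t' < t, ∀ j < p, s.arr 3 t' j = dropEntry D i t' j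

/-- The invariant of the loop over `copyEntry`: the response and the first `j` design entries of
row `t` have been copied. -/
structure CopiedEntries (slr : SLRSolver) (n p k : ℕ) (D : ℕ → ℕ → ℝ) (i t j : ℕ) (s : MState) :
    Prop extends Copied slr n p k D i t s where
  idx4 : s.idx 4 = t
  arr2_row : s.arr 2 t 0 = D t i
  arr3_row : ∀ j' < j, s.arr 3 t j' = dropEntry D i t j'

/-- All rows have been copied and array `4` holds the answer of the black box. -/
structure Solved (slr : SLRSolver) (n p k : ℕ) (D : ℕ → ℕ → ℝ) (i : ℕ) (s : MState) : Prop
    extends Copied slr n p k D i n s where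
  arr4 : ∀ j < p, s.arr 4 j 0 = estimate slr n p k D i j

/-- The invariant of the loop over `addRow`: the first `t` rows have been added to `n Qᵢ`. -/
structure Summed (slr : SLRSolver) (n p k : ℕ) (D : ℕ → ℕ → ℝ) (i t : ℕ) (s : MState) : Prop
    extends Solved slr n p k D i s where
  arr5 : s.arr 5 0 0 = partialStat slr n p k D i t

/-- The invariant of the loop over `addProduct`: `m` terms of the prediction in row `t` have been
added up. -/
structure SummedProducts (slr : SLRSolver) (n p k : ℕ) (D : ℕ → ℕ → ℝ) (i t m : ℕ) (s : MState) :
    Prop extends Summed slr n p k D i t s where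
  idx4 : s.idx 4 = t
  arr6 : s.arr 6 0 0 = partialPred slr n p k D i t m

variable {slr : SLRSolver} {n p k i t m : ℕ} {D : ℕ → ℕ → ℝ} {s s' : MState}

lemma Decided.congr (h : Decided slr n p k D i s) (hs : s.AgreeBelow 3 1 s')
    (h_arr : ∀ i' < i, s'.arr 1 i' 0 = s.arr 1 i' 0) : Decided slr n p k D i s' where
  idx0 := (hs.1 0 (by norm_num)).trans h.idx0
  idx1 := (hs.1 1 (by norm_num)).trans h.idx1
  idx2 := (hs.1 2 (by norm_num)).trans h.idx2
  arr0 := (hs.2 0 (by norm_num)).trans h.arr0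
  arr1 i' hi' := (h_arr i' hi').trans (h.arr1 i' hi')

lemma Copied.congr (h : Copied slr n p k D i t s) (hs : s.AgreeBelow 4 4 s') :
    Copied slr n p k D i t s' where
  toDecided := h.toDecided.congr (hs.mono (by norm_num) (by norm_num)) fun i' _ => by
    rw [hs.2 1 (by norm_num)]
  idx3 := (hs.1 3 (by norm_num)).trans h.idx3
  arr2 t' ht' := by rw [hs.2 2 (by norm_num), h.arr2 t' ht']
  arr3 t' ht' j hj := by rw [hs.2 3 (by norm_num), h.arr3 t' ht' j hj]

lemma Solved.congr (h : Solved slr n p k D i s) (hs : s.AgreeBelow 4 5 s') :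
    Solved slr n p k D i s' where
  toCopied := h.toCopied.congr (hs.mono le_rfl (by norm_num))
  arr4 j hj := by rw [hs.2 4 (by norm_num), h.arr4 j hj]

lemma Summed.congr (h : Summed slr n p k D i t s) (hs : s.AgreeBelow 4 6 s') :
    Summed slr n p k D i t s' where
  toSolved := h.toSolved.congr (hs.mono le_rfl (by norm_num))
  arr5 := by rw [hs.2 5 (by norm_num), h.arr5]

lemma CopiedEntries.congr (h : CopiedEntries slr n p k D i t m s) (hs : s.AgreeBelow 5 4 s') :
    CopiedEntries slr n p k D i t m s' where
  toCopied := h.toCopied.congr (hs.mono (by norm_num) le_rfl)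
  idx4 := (hs.1 4 (by norm_num)).trans h.idx4
  arr2_row := by rw [hs.2 2 (by norm_num), h.arr2_row]
  arr3_row j hj := by rw [hs.2 3 (by norm_num), h.arr3_row j hj]

lemma SummedProducts.congr (h : SummedProducts slr n p k D i t m s)
    (hs : s.AgreeBelow 5 7 s') : SummedProducts slr n p k D i t m s' where
  toSummed := h.toSummed.congr (hs.mono (by norm_num) (by norm_num))
  idx4 := (hs.1 4 (by norm_num)).trans h.idx4
  arr6 := by rw [hs.2 6 (by norm_num), h.arr6]

lemma CopiedEntries.setReal_dropEntry (h : CopiedEntries slr n p k D i t m s) :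
    CopiedEntries slr n p k D i t (m + 1) (s.setReal 3 t m (dropEntry D i t m)) where
  toDecided := h.toDecided.congr (s.agreeBelow_setReal 3 3 _ _ _ |>.mono le_rfl (by norm_num))
    fun _ _ => by simp [MState.setReal]
  idx3 := h.idx3
  arr2 t' ht' := by simpa [MState.setReal] using h.arr2 t' ht'
  arr3 t' ht' j hj := by simpa [MState.setReal, ht'.ne] using h.arr3 t' ht' j hj
  idx4 := h.idx4
  arr2_row := by simpa [MState.setReal] using h.arr2_row
  arr3_row j hj := by
    rcases Nat.lt_succ_iff_lt_or_eq.1 hj with h_lt | rfl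
    · simpa [MState.setReal, h_lt.ne] using h.arr3_row j h_lt
    · simp [MState.setReal]

lemma CopiedEntries.copied (h : CopiedEntries slr n p k D i t p s) :
    Copied slr n p k D i (t + 1) s where
  toDecided := h.toDecided
  idx3 := h.idx3
  arr2 t' ht' := by
    rcases Nat.lt_succ_iff_lt_or_eq.1 ht' with h_lt | rfl
    exacts [h.arr2 t' h_lt, h.arr2_row]
  arr3 t' ht' := by
    rcases Nat.lt_succ_iff_lt_or_eq.1 ht' with h_lt | rfl
    exacts [h.arr3 t' h_lt, h.arr3_row]

lemma Copied.setReal_response (h : Copied slr n p k D i t s) (h_row : s.idx 4 = t) :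
    CopiedEntries slr n p k D i t 0 (s.setReal 2 t 0 (D t i)) where
  toDecided := h.toDecided.congr (s.agreeBelow_setReal 3 2 _ _ _ |>.mono le_rfl (by norm_num))
    fun _ _ => by simp [MState.setReal]
  idx3 := h.idx3
  arr2 t' ht' := by simpa [MState.setReal, ht'.ne] using h.arr2 t' ht'
  arr3 t' ht' j hj := by simpa [MState.setReal] using h.arr3 t' ht' j hj
  idx4 := h_row
  arr2_row := by simp [MState.setReal]
  arr3_row _ hj := absurd hj (Nat.not_lt_zero _)

lemma Copied.setVec_answer (h : Copied slr n p k D i n s) :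
    Solved slr n p k D i (s.setVec 4 (slr n p (fun t : Fin n => s.arr 2 t 0)
      (Matrix.of fun (t : Fin n) (j : Fin p) => s.arr 3 t j) k)) where
  toCopied := h.congr (s.agreeBelow_setVec 4 4 _)
  arr4 j hj := by
    have h_response : (fun t : Fin n => s.arr 2 t 0) = fun t : Fin n => D t i :=
      funext fun t => h.arr2 t t.2
    have h_design : (Matrix.of fun (t : Fin n) (j : Fin p) => s.arr 3 t j) =
        Matrix.of fun (t : Fin n) (j : Fin p) => dropEntry D i t j :=
      Matrix.ext fun t j => h.arr3 t t.2 j j.2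
    simp [MState.setVec, estimate, hj, h_response, h_design]

lemma Decided.setReal_decision (h : Decided slr n p k D i s) :
    Decided slr n p k D (i + 1) (s.setReal 1 i 0 (decision slr n p k D i)) := by
  have h_old := h.congr (s.agreeBelow_setReal 3 1 i 0 (decision slr n p k D i))
    fun i' hi' => by simp [MState.setReal, hi'.ne]
  refine { h_old with arr1 := fun i' hi' => ?_ }
  rcases Nat.lt_succ_iff_lt_or_eq.1 hi' with h_lt | rfl
  · exact h_old.arr1 i' h_lt
  · simp [MState.setReal]

end Invariants

section Correctness

variable {slr : SLRSolver} {T : ℕ → ℕ → ℕ → ℕ} {n p k i t m : ℕ} {D : ℕ → ℕ → ℝ}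

lemma triple_copyEntry :
    Prog.Triple slr T (fun s => CopiedEntries slr n p k D i t m s ∧ s.idx 5 = m) copyEntry
      (CopiedEntries slr n p k D i t (m + 1)) 20 := by
  refine (Prog.Triple.ifIdxLt (K := 8) ((Prog.Triple.setReal ?_).mono ?_)
    ((Prog.Triple.setReal ?_).mono ?_)).mono ?_
  · rintro s ⟨⟨h, h_col⟩, h_lt⟩
    simp only [IdxExp.eval, h_col, h.idx3] at h_lt
    have h_set := h.setReal_dropEntry
    rw [dropEntry, if_pos h_lt] at h_set
    simpa only [IdxExp.eval, RealExp.eval, h_col, h.idx4, h.arr0] using h_set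
  · simp [IdxExp.cost, RealExp.cost]
  · rintro s ⟨⟨h, h_col⟩, h_le⟩
    simp only [IdxExp.eval, h_col, h.idx3] at h_le
    have h_set := h.setReal_dropEntry
    rw [dropEntry, if_neg h_le] at h_set
    simpa only [IdxExp.eval, RealExp.eval, h_col, h.idx4, h.arr0] using h_set
  · simp [IdxExp.cost, RealExp.cost]
  · simp [IdxExp.cost]

lemma triple_copyRow :
    Prog.Triple slr T (fun s => Copied slr n p k D i t s ∧ s.idx 4 = t) copyRow
      (Copied slr n p k D i (t + 1)) (21 * p + 20) := by
  have h_response : Prog.Triple slr T (fun s => Copied slr n p k D i t s ∧ s.idx 4 = t)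
      (.setReal 2 (.reg 4) (.const 0) (.get 0 (.reg 4) (.reg 3)))
      (CopiedEntries slr n p k D i t 0) 6 := by
    refine Prog.Triple.setReal fun s hs => ?_
    simpa only [IdxExp.eval, RealExp.eval, hs.2, hs.1.idx3, hs.1.arr0] using
      hs.1.setReal_response hs.2
  have h_entries := Prog.Triple.loop (slr := slr) (T := T) (r := 5)
    (e := .sub (.reg 1) (.const 1)) (I := CopiedEntries slr n p k D i t) (M := p)
    (fun s hs => by simp [IdxExp.eval, hs.idx1])
    (fun m x s hs => hs.congr (s.agreeBelow_setIdx 5 4 x)) (fun m _ => triple_copyEntry)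
  refine Prog.Triple.mono (fun s hs => ?_) (K₁ := 21 * p + 10) (by lia)
  obtain ⟨h_copied, h_cost⟩ := h_response.seq h_entries s hs
  exact ⟨h_copied.copied, h_cost.trans (by simp only [IdxExp.cost]; lia)⟩

lemma triple_callSLR :
    Prog.Triple slr T (Copied slr n p k D i n)
      (.callSLR 4 2 3 (.reg 0) (.sub (.reg 1) (.const 1)) (.reg 2))
      (Solved slr n p k D i) (T p n k + 6) := by
  intro s hs
  have h_dim : (IdxExp.sub (.reg 1) (.const 1)).eval s = p := by simp [IdxExp.eval, hs.idx1]
  have h_rows : (IdxExp.reg 0).eval s = n := hs.idx0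
  have h_sparsity : (IdxExp.reg 2).eval s = k := hs.idx2
  rw [Prog.run, h_dim, h_rows, h_sparsity]
  exact ⟨hs.setVec_answer, le_rfl⟩

lemma triple_addProduct (ht : t < n) (hm : m < p) :
    Prog.Triple slr T (fun s => SummedProducts slr n p k D i t m s ∧ s.idx 5 = m) addProduct
      (SummedProducts slr n p k D i t (m + 1)) 20 := by
  refine (Prog.Triple.setReal ?_).mono (by simp [IdxExp.cost, RealExp.cost])
  rintro s ⟨h, h_col⟩
  refine ⟨h.toSummed.congr (s.agreeBelow_setReal 4 6 _ _ _), h.idx4, ?_⟩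
  rw [partialPred, Finset.sum_range_succ, ← partialPred, ← h.arr6, ← h.arr3 t ht m hm,
    ← h.arr4 m hm]
  simp [MState.setReal, IdxExp.eval, RealExp.eval, h.idx4, h_col]

lemma triple_addRow (ht : t < n) :
    Prog.Triple slr T (fun s => Summed slr n p k D i t s ∧ s.idx 4 = t) addRow
      (Summed slr n p k D i (t + 1)) (21 * p + 60) := by
  have h_init : Prog.Triple slr T (fun s => Summed slr n p k D i t s ∧ s.idx 4 = t)
      (.setReal 6 (.const 0) (.const 0) (.ofIdx (.const 0)))
      (SummedProducts slr n p k D i t 0) 5 := by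
    refine Prog.Triple.setReal fun s hs =>
      ⟨hs.1.congr (s.agreeBelow_setReal 4 6 _ _ _), hs.2, ?_⟩
    simp [MState.setReal, IdxExp.eval, RealExp.eval, partialPred]
  have h_products := Prog.Triple.loop (slr := slr) (T := T) (r := 5)
    (e := .sub (.reg 1) (.const 1)) (I := SummedProducts slr n p k D i t) (M := p)
    (fun s hs => by simp [IdxExp.eval, hs.idx1])
    (fun m x s hs => hs.congr (s.agreeBelow_setIdx 5 7 x)) (fun m hm => triple_addProduct ht hm)
  refine (h_init.seq (h_products.seq (Prog.Triple.setReal ?_))).mono ?_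
  · intro s h
    refine ⟨h.toSolved.congr (s.agreeBelow_setReal 4 5 _ _ _), ?_⟩
    rw [partialStat, Finset.sum_range_succ, ← partialStat, ← h.arr5, ← h.arr6, ← h.arr2 t ht]
    simp [MState.setReal, IdxExp.eval, RealExp.eval, h.idx4]
  · simp only [IdxExp.cost, RealExp.cost]
    lia

lemma triple_decideCoord :
    Prog.Triple slr T (Summed slr n p k D i n) decideCoord (Decided slr n p k D (i + 1)) 40 := by
  refine (Prog.Triple.ifRealLt (K := 6) ((Prog.Triple.setReal ?_).mono ?_)
    ((Prog.Triple.setReal ?_).mono ?_)).mono ?_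
  · rintro s ⟨h, h_lt⟩
    simp only [RealExp.eval, IdxExp.eval, h.idx0, h.idx1, h.idx2, h.arr5] at h_lt
    have h_set := h.setReal_decision
    rw [decision, if_pos (by exact_mod_cast h_lt)] at h_set
    simpa only [IdxExp.eval, RealExp.eval, h.idx3, Nat.cast_one] using h_set
  · simp [IdxExp.cost, RealExp.cost]
  · rintro s ⟨h, h_le⟩
    simp only [RealExp.eval, IdxExp.eval, h.idx0, h.idx1, h.idx2, h.arr5] at h_le
    have h_set := h.setReal_decision
    rw [decision, if_neg (by exact_mod_cast h_le)] at h_set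
    simpa only [IdxExp.eval, RealExp.eval, h.idx3, Nat.cast_zero] using h_set
  · simp [IdxExp.cost, RealExp.cost]
  · simp [IdxExp.cost, RealExp.cost]

lemma triple_coordStep (hn : 1 ≤ n) :
    Prog.Triple slr T (fun s => Decided slr n p k D i s ∧ s.idx 3 = i) coordStep
      (Decided slr n p k D (i + 1)) (T p n k + 200 * (n * (p + 1))) := by
  have h_copy := Prog.Triple.loop (slr := slr) (T := T) (r := 4) (e := .reg 0)
    (I := Copied slr n p k D i) (fun s hs => hs.idx0)
    (fun t x s hs => hs.congr (s.agreeBelow_setIdx 4 4 x)) (fun t _ => triple_copyRow)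
  have h_zero : Prog.Triple slr T (Solved slr n p k D i)
      (.setReal 5 (.const 0) (.const 0) (.ofIdx (.const 0))) (Summed slr n p k D i 0) 5 := by
    refine Prog.Triple.setReal fun s hs => ⟨hs.congr (s.agreeBelow_setReal 4 5 _ _ _), ?_⟩
    simp [MState.setReal, IdxExp.eval, RealExp.eval, partialStat]
  have h_add := Prog.Triple.loop (slr := slr) (T := T) (r := 4) (e := .reg 0)
    (I := Summed slr n p k D i) (fun s hs => hs.idx0)
    (fun t x s hs => hs.congr (s.agreeBelow_setIdx 4 6 x)) (fun t ht => triple_addRow ht)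
  have h_step := h_copy.seq (triple_callSLR.seq (h_zero.seq (h_add.seq triple_decideCoord)))
  rintro s ⟨hs, h_coord⟩
  refine h_step.mono ?_ s ⟨hs, h_coord, by simp, by simp⟩
  simp only [IdxExp.cost]
  nlinarith

theorem program_spec (slr : SLRSolver) (T : ℕ → ℕ → ℕ → ℕ) (hn : 1 ≤ n)
    (X : Matrix (Fin n) (Fin (p + 1)) ℝ) (k : ℕ) :
    (program.run slr T (initState X k)).1.Outputs (qSupport slr X k) ∧
      (program.run slr T (initState X k)).2 ≤
        300 * ((p + 1) * T p n k + (p + 1) ^ 2 * n) := by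
  have h_loop := Prog.Triple.loop (slr := slr) (T := T) (r := 3) (e := .reg 1)
    (I := Decided slr n p k ((initState X k).arr 0)) (fun s hs => hs.idx1)
    (fun i x s hs => hs.congr (s.agreeBelow_setIdx 3 1 x) fun _ _ => rfl)
    (fun i _ => triple_coordStep hn)
  obtain ⟨h_decided, h_cost⟩ := h_loop (initState X k)
    ⟨by simp [initState], by simp [initState], by simp [initState], rfl, by simp⟩
  refine ⟨fun i => ?_, h_cost.trans ?_⟩
  · rw [program, h_decided.arr1 i i.2, decision, partialStat_initState_div]
    simp [qSupport]
  · simp only [IdxExp.cost]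
    nlinarith [Nat.zero_le (p * T p n k), Nat.zero_le (p * n), Nat.zero_le (p ^ 2 * n)]

end Correctness

end QRecovery

theorem theorem2 :
    -- success probability of `Q`-support recovery (the dimension is `d = p + 1`)
    (∀ c c' c'' : ℝ, 0 < c → 0 < c' → 0 < c'' →
      ∃ c₁ c₂ c₃ c₄ : ℝ, 0 < c₁ ∧ 0 < c₂ ∧ 0 < c₃ ∧ 0 < c₄ ∧
        ∀ slr : SLRSolver, slr.IsMeasurable → slr.BlackBox c c' c'' →
        ∀ (n p k : ℕ) (θ cmin ε : ℝ) (u : EuclideanSpace ℝ (Fin (p + 1))),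
          0 < cmin → cmin < 1 →
          ‖u‖ = 1 → IsSparse k u → SpikeSpread k cmin u → SpikeMin k cmin u →
          Real.exp 1 * k ≤ ((p + 1 : ℕ) : ℝ) →
          0 < ε → (k : ℝ) ≤ ((p + 1 : ℕ) : ℝ) ^ (1 - ε) →
          0 < θ → θ ≤ 1 →
          c₁ / cmin ^ 2 * ((k : ℝ) ^ 2 * Real.log ((p + 1 : ℕ) : ℝ) / n) < θ ^ 2 →
          c₂ * k * Real.log ((p + 1 : ℕ) : ℝ) < n →
          1 - c₃ * Real.exp (-(c₄ * ε) * k * Real.log ((p + 1 : ℕ) : ℝ)) ≤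
            (spikedLaw n θ u).real {x | qSupport slr (dataMatrix x) k = suppF u}) ∧
    -- running time `O(d T + d² n)`
    (∃ (prog : Prog) (C : ℕ), ∀ (slr : SLRSolver) (T : ℕ → ℕ → ℕ → ℕ) (n p k : ℕ), 1 ≤ n →
      ∀ X : Matrix (Fin n) (Fin (p + 1)) ℝ,
        (prog.run slr T (initState X k)).1.Outputs (qSupport slr X k) ∧
        (prog.run slr T (initState X k)).2 ≤ C * ((p + 1) * T p n k + (p + 1) ^ 2 * n)) := by
  refine ⟨fun c c' c'' hc hc' hc'' => ⟨8 * (220 + 128 * c), 12 * 1034, 3 + c' * (4 / c''),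
    min (1 / 2) (c'' / 4), by positivity, by norm_num, by positivity, by positivity, ?_⟩,
    QRecovery.program, 300, fun slr T n p k hn X => QRecovery.program_spec slr T hn X k⟩
  intro slr hm hs n p k θ cmin ε u hcmin _ hu husp hspread hmin hd _ hkε hθ hθ1 hsig hn
  have h_fail := spikedLaw_qSupport_ne_suppF_le hc hc' hc'' hm hs hcmin hu husp hspread hmin hd
    hθ.le hθ1 hsig.le hn.le
  have h_log := mul_log_le_log_div (Nat.cast_pos.2 (sparsity_pos hu husp)) (by positivity) hkε
  calc 1 - (3 + c' * (4 / c'')) *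
        Real.exp (-(min (1 / 2) (c'' / 4) * ε) * k * Real.log ((p + 1 : ℕ) : ℝ))
      = 1 - (3 + c' * (4 / c'')) *
          Real.exp (-(min (1 / 2) (c'' / 4) * k * (ε * Real.log ((p + 1 : ℕ) : ℝ)))) := by
        ring_nf
    _ ≤ 1 - (3 + c' * (4 / c'')) *
          Real.exp (-(min (1 / 2) (c'' / 4) * k * Real.log (((p + 1 : ℕ) : ℝ) / k))) := by
        gcongr
    _ ≤ 1 - (spikedLaw n θ u).real {x | qSupport slr (dataMatrix x) k ≠ suppF u} := by
        gcongr
    _ ≤ (spikedLaw n θ u).real {x | qSupport slr (dataMatrix x) k = suppF u} :=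
        one_sub_measureReal_compl_le _
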